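/- Let $a=\alpha+i\beta$ with $\alpha<0<\beta$, and let $\sqrt{\cdot}$ denote the principal square root. Let $P_a=\{4av(v+i):v\in\mathbb R\}$; this is a parabola with vertex at the origin, and its interior is $\{4av(v+i):v\in\mathbb C,\ -1<\operatorname{Im}v<0\}$. By a nontrivial zero of $\zeta$ we mean a zero other than $-2,-4,-6,\dots$. Let $Z_a$ be the set of nontrivial zeros of $\zeta$ in the interior of $P_a$ (the *enclosed* zeros). Assume that * $\displaystyle \beta\neq-\alpha\,\frac{\sqrt{-(4\alpha+2L)\alpha}}{2\alpha+L}$ for every positive integer $L$ with $2\alpha+L>0$ (equivalently, no trivial zero lies on $P_a$); * no nontrivial zero of $\zeta$ lies on $P_a$; * all zeros $\tau\in Z_a$ are simple. Put $N=\lfloor-2\alpha|a|^2/\beta^2\rfloor$. Then the function $v\mapsto \dfrac{1}{\zeta(4av(v+i))\cosh(\pi v)}$ is integrable on $\mathbb R$, the set $Z_a$ is finite, and $$\int_{-\infty}^{\infty}\frac{dv}{\zeta(4av(v+i))\cosh(\pi v)}=\frac1{\zeta(a)}-\frac{\pi}{2}\sum_{n=1}^{N}\frac{1}{\zeta'(-2n)\sqrt{a^2+2an}\,\sin\!\left(\frac{\pi\sqrt{a^2+2an}}{2a}\right)}+\frac{\pi}{2}\sum_{\tau\in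 Z_a}\frac{1}{\sqrt{-a(a-\tau)}\;\zeta'(\tau)\sinh\!\left(\frac{\pi\sqrt{-a(a-\tau)}}{2a}\right)} .$$ (The summands do not depend on the choice of the square roots.) If every $\tau=\sigma+i\rho\in Z_a$ satisfies $\alpha\rho+(\sigma-2\alpha)\beta<0$, then $\sqrt{a}\sqrt{\tau-a}=-\sqrt{-a(a-\tau)}$ for these zeros, and the last term can be written as $$-\frac{\pi}{2\sqrt a}\sum_{\tau\in Z_a}\frac{1}{\sqrt{-a+\tau}\;\zeta'(\tau)\sinh\!\left(\frac{\pi\sqrt{-a(a-\tau)}}{2a}\right)} .$$ Moreover, set $$\tau_{M_\pm}=\frac12\,\frac{\beta(4|a|^2+\alpha)}{\alpha^2}\pm\frac{|a|^2\sqrt{4\beta^2+2\alpha}}{\alpha^2}.$$ A nontrivial zero $\tau$ with $\operatorname{Re}\tau=\frac12$ is enclosed if and only if $4\beta^2+2\alpha\ge0$ and $\tau_{M_-}\le\operatorname{Im}\tau\le\tau_{M_+}$. In particular, if all nontrivial zeros lie on the critical line (the Riemann hypothesis), then $Z_a$ is exactly the set of nontrivial zeros satisfying these two conditions (so $Z_a$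 is empty if $4\beta^2+2\alpha<0$). -/

import Mathlib

/-- The bounding parabola of parameter `a`: the image of the real axis under
`v ↦ 4 a v (v + i)`. -/
def boundingParabola (a : ℂ) : Set ℂ :=
  {z | ∃ v : ℝ, z = 4 * a * v * (v + Complex.I)}

/-- The interior of the bounding parabola: the image under `v ↦ 4 a v (v + i)` of the open strip
`-1 < Im v < 0`. -/
def parabolaInterior (a : ℂ) : Set ℂ :=
  {z | ∃ v : ℂ, -1 < v.im ∧ v.im < 0 ∧ z = 4 * a * v * (v + Complex.I)}

/-- The nontrivial zeros of the Riemann zeta function: all zeros other than `-2, -4, -6, …`. -/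
def nontrivialZetaZeros : Set ℂ :=
  {τ | riemannZeta τ = 0 ∧ ¬ ∃ n : ℕ, τ = -2 * ((n : ℂ) + 1)}

/-- The nontrivial zeros enclosed by the parabola of parameter `a`. -/
def enclosedZeros (a : ℂ) : Set ℂ := nontrivialZetaZeros ∩ parabolaInterior a

/-- The correction due to the trivial zero `-2n`,
`(π/2) / (ζ'(-2n) √(a² + 2an) sin (π √(a² + 2an) / (2a)))`. -/
noncomputable def trivialZeroTerm (a : ℂ) (n : ℕ) : ℂ :=
  (Real.pi / 2 : ℂ) *
    (1 / (deriv riemannZeta (-2 * (n : ℂ)) * Complex.sqrt (a ^ 2 + 2 * a * n) *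
      Complex.sin (Real.pi * Complex.sqrt (a ^ 2 + 2 * a * n) / (2 * a))))

/-- The correction due to a nontrivial zero `τ`,
`(π/2) / (√(-a(a-τ)) ζ'(τ) sinh (π √(-a(a-τ)) / (2a)))`; it does not depend on which of the two
square roots of `-a(a-τ)` is used. -/
noncomputable def nontrivialZeroTerm (a τ : ℂ) : ℂ :=
  (Real.pi / 2 : ℂ) *
    (1 / (Complex.sqrt (-a * (a - τ)) * deriv riemannZeta τ *
      Complex.sinh (Real.pi * Complex.sqrt (-a * (a - τ)) / (2 * a))))

/-- The lower bound `τ_{M₋}` for the imaginary parts of the enclosed zeros. -/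
noncomputable def tauMinus (α β : ℝ) : ℝ :=
  (1 / 2) * (β * (4 * (α ^ 2 + β ^ 2) + α) / α ^ 2)
    - (α ^ 2 + β ^ 2) * √(4 * β ^ 2 + 2 * α) / α ^ 2

/-- The upper bound `τ_{M₊}` for the imaginary parts of the enclosed zeros. -/
noncomputable def tauPlus (α β : ℝ) : ℝ :=
  (1 / 2) * (β * (4 * (α ^ 2 + β ^ 2) + α) / α ^ 2)
    + (α ^ 2 + β ^ 2) * √(4 * β ^ 2 + 2 * α) / α ^ 2

/-! ### Residue calculus in the strip `-1 ≤ Im v ≤ 0` -/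

section ContourIntegration
open Complex MeasureTheory Filter Topology Set

/-! Put `s(v) = 4av(v+i)` and `F(v) = 1 / (ζ(s(v)) cosh πv)`. The reflection `v ↦ -i - v` exchanges
the edges of the strip `-1 ≤ Im v ≤ 0`, fixes `s` and reverses the sign of `cosh πv`. The two edges
therefore contribute equally to the contour integral, and the integral over `ℝ` is `-πi` times the
sum of the residues in the strip (`integral_eq_sum_residues_of_odd_reflection`).

The pole of `1 / cosh` at the centre `-i/2`, where `s = a`, gives `1/ζ(a)`. Every other pole lies
over a zero `τ` of `ζ` inside the parabola: since `s(-i/2 + u) = a + 4au²`, there are two preimages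
`-i/2 ± u`, with equal residues because the residue is even in `u`. Enclosed trivial zeros are
automatically simple and number `N`; this is `integral_stripIntegrand` combined with
`mem_riemannZetaZeros_inter_parabolaInterior_iff`.

Convergence and finiteness rest on `α < 0 < β`: far out in the strip `s(v)` lies far to the left and
away from the real axis, where the functional equation bounds `|ζ|` below
(`exists_pos_le_norm_riemannZeta_of_re_le`).

Which zeros are enclosed is read off from one real inequality, `(Im z ā)² < 4|a|² Re z ā`
(`mem_parabolaInterior_iff`), which on the critical line is quadratic in the ordinate. The
alternative form of the last sum is a comparison of branches of the square root
(`sqrt_mul_sqrt_eq_neg`). -/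

/-- Subtracting the principal parts of finitely many simple poles leaves a function which is
holomorphic after redefinition at the poles. -/
lemma exists_differentiableAt_sub_principalParts {F : ℂ → ℂ} {S : Set ℂ} (P : Finset ℂ) (r : ℂ → ℂ)
    (hS : ∀ p ∈ P, S ∈ 𝓝 p)
    (hd : ∀ v ∈ S, v ∉ P → DifferentiableAt ℂ F v)
    (hr : ∀ p ∈ P, Tendsto (fun v => (v - p) * F v) (𝓝[≠] p) (𝓝 (r p))) :
    ∃ G : ℂ → ℂ, (∀ v ∈ S, DifferentiableAt ℂ G v) ∧
      ∀ v ∉ P, G v = F v - ∑ p ∈ P, r p / (v - p) := by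
  classical
  set g : ℂ → ℂ := fun v => F v - ∑ p ∈ P, r p / (v - p) with hg
  have hgd : ∀ v ∈ S, v ∉ P → DifferentiableAt ℂ g v := by
    intro v hv hvP
    refine (hd v hv hvP).sub ?_
    refine DifferentiableAt.fun_sum fun p hp => ?_
    have : v - p ≠ 0 := sub_ne_zero.2 fun h => hvP (h ▸ hp)
    fun_prop (disch := assumption)
  have hPc : ∀ p : ℂ, ∀ᶠ v in 𝓝[≠] p, v ∉ P := by
    intro p
    have h1 : ((P.erase p : Finset ℂ) : Set ℂ)ᶜ ∈ 𝓝 p :=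
      (Finset.finite_toSet _).isClosed.isOpen_compl.mem_nhds (by simp)
    filter_upwards [mem_nhdsWithin_of_mem_nhds h1, self_mem_nhdsWithin] with v hv hv'
    exact fun h => hv (by simpa [h] using hv')
  have hlim : ∀ p ∈ P, Tendsto (fun v => (v - p) * g v) (𝓝[≠] p) (𝓝 0) := by
    intro p hp
    have h2 : Tendsto (fun v => ∑ q ∈ P, (v - p) * (r q / (v - q))) (𝓝[≠] p)
        (𝓝 (∑ q ∈ P, if q = p then r q else 0)) := by
      refine tendsto_finsetSum _ fun q hq => ?_
      split_ifs with h
      · subst h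
        refine tendsto_const_nhds.congr' ?_
        filter_upwards [self_mem_nhdsWithin] with v hv
        have : v - q ≠ 0 := sub_ne_zero.2 hv
        field_simp
      · have hc : ContinuousAt (fun v => (v - p) * (r q / (v - q))) p := by
          have : p - q ≠ 0 := sub_ne_zero.2 fun h' => h h'.symm
          fun_prop (disch := assumption)
        have := hc.tendsto
        simp only [sub_self, zero_mul] at this
        exact this.mono_left nhdsWithin_le_nhds
    have h3 := (hr p hp).sub h2
    rw [Finset.sum_ite_eq' P p, if_pos hp, sub_self] at h3
    refine h3.congr fun v => ?_
    simp only [hg, mul_sub, Finset.mul_sum]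
  refine ⟨fun v => if v ∈ P then limUnder (𝓝[≠] v) g else g v, ?_, ?_⟩
  · intro v hv
    by_cases hvP : v ∈ P
    · have hev : ∀ᶠ w in 𝓝[≠] v, DifferentiableAt ℂ g w := by
        filter_upwards [hPc v, mem_nhdsWithin_of_mem_nhds (hS v hvP)] with w hw hwS
        exact hgd w hwS hw
      -- Removable singularity criterion: `g = o(1/(z - v))`. The constant `g v` is a default value
      -- and does not affect the limit.
      have hlo : (fun z => g z - g v) =o[𝓝[≠] v] fun z => (z - v)⁻¹ := by
        refine Asymptotics.isLittleO_of_tendsto' ?_ ?_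
        · filter_upwards [self_mem_nhdsWithin] with z hz hz'
          rw [inv_eq_zero, sub_eq_zero] at hz'
          exact absurd hz' hz
        · have h4 : Tendsto (fun z : ℂ => (z - v) * g v) (𝓝[≠] v) (𝓝 0) := by
            have hc : ContinuousAt (fun z : ℂ => (z - v) * g v) v := by fun_prop
            have := hc.tendsto
            simp only [sub_self, zero_mul] at this
            exact this.mono_left nhdsWithin_le_nhds
          have := (hlim v hvP).sub h4
          rw [sub_zero] at this
          refine this.congr fun z => ?_
          rw [div_inv_eq_mul]; ring
      have hdo := differentiableOn_update_limUnder_insert_of_isLittleO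
        (s := {w | DifferentiableAt ℂ g w}) hev
        (fun w hw => DifferentiableAt.differentiableWithinAt hw) hlo
      have hda := hdo.differentiableAt (insert_mem_nhds_iff.2 hev)
      refine hda.congr_of_eventuallyEq ?_
      have := hPc v
      rw [eventually_nhdsWithin_iff] at this
      filter_upwards [this] with w hw
      by_cases hwv : w = v
      · subst hwv; simp [hvP]
      · simp [Function.update_of_ne hwv, hw hwv]
    · refine (hgd v hv hvP).congr_of_eventuallyEq ?_
      have h1 : (P : Set ℂ)ᶜ ∈ 𝓝 v :=
        P.finite_toSet.isClosed.isOpen_compl.mem_nhds (by simpa using hvP)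
      filter_upwards [h1] with w hw
      have : w ∉ P := by simpa using hw
      simp [this]
  · intro v hv
    simp [hv, hg]

/-- The principal value integral of `1 / (x + c)` along the real axis, for `c` in the upper
half-plane. -/
lemma tendsto_integral_inv_add {c : ℂ} (hc : 0 < c.im) :
    Tendsto (fun R : ℝ => ∫ x in (-R)..R, 1 / ((x : ℂ) + c)) atTop (𝓝 (-(Real.pi * I))) := by
  have hint : ∀ R : ℝ, ∫ x in (-R)..R, 1 / ((x : ℂ) + c) = log (R + c) - log (-R + c) := by
    intro R
    have := intervalIntegral.integral_eq_sub_of_hasDerivAt (a := -R) (b := R)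
      (f := fun x : ℝ => log ((x : ℂ) + c)) (f' := fun x : ℝ => 1 / ((x : ℂ) + c)) ?_ ?_
    · simpa using this
    · intro x _
      have h1 : HasDerivAt (fun x : ℝ => (x : ℂ) + c) 1 x := by
        simpa using (hasDerivAt_id x).ofReal_comp.add_const c
      exact h1.clog_real (by right; simpa using hc.ne')
    · refine Continuous.intervalIntegrable ?_ _ _
      refine continuous_const.div (by fun_prop) fun x h => ?_
      have := congrArg im h
      simp at this
      exact hc.ne' this
  have h0 : Tendsto (fun R : ℝ => c / R) atTop (𝓝 0) := by
    have : Tendsto (fun R : ℝ => ((R⁻¹ : ℝ) : ℂ)) atTop (𝓝 ((0 : ℝ) : ℂ)) :=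
      (continuous_ofReal.tendsto 0).comp tendsto_inv_atTop_zero
    have := this.const_mul c
    simpa [div_eq_mul_inv] using this
  have h1 : Tendsto (fun R : ℝ => log (1 + c / R)) atTop (𝓝 0) := by
    have h : Tendsto (fun R : ℝ => 1 + c / R) atTop (𝓝 1) := by simpa using h0.const_add 1
    have := (continuousAt_clog (x := 1) (by simp)).tendsto.comp h
    simpa [Function.comp_def] using this
  have h2 : Tendsto (fun R : ℝ => log (-1 + c / R)) atTop (𝓝 (Real.pi * I)) := by
    have h : Tendsto (fun R : ℝ => -1 + c / R) atTop (𝓝 (-1)) := by simpa using h0.const_add (-1)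
    -- The point `-1` lies on the branch cut; `Im c > 0` makes the approach come from above, which
    -- selects `πi` rather than `-πi`.
    have hw := (continuousWithinAt_log_of_re_neg_of_im_zero (z := -1) (by simp) (by simp)).tendsto
    have h' : Tendsto (fun R : ℝ => -1 + c / R) atTop (𝓝[{z | 0 ≤ z.im}] (-1)) := by
      refine tendsto_nhdsWithin_iff.2 ⟨h, ?_⟩
      filter_upwards [eventually_gt_atTop 0] with R hR
      simp only [add_im, neg_im, one_im, neg_zero, zero_add, div_ofReal_im]
      positivity
    have := hw.comp h'
    simpa [log_neg_one, Function.comp_def] using this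
  have h3 := h1.sub h2
  rw [zero_sub] at h3
  refine h3.congr' ?_
  filter_upwards [eventually_gt_atTop 0] with R hR
  rw [hint R]
  have hR' : (R : ℂ) ≠ 0 := by exact_mod_cast hR.ne'
  have e1 : (R : ℂ) + c = R * (1 + c / R) := by field_simp
  have e2 : -(R : ℂ) + c = R * (-1 + c / R) := by field_simp
  have n1 : 1 + c / R ≠ 0 := by
    intro h
    have := congrArg im h
    simp at this
    rcases this with h | h <;> linarith
  have n2 : -1 + c / R ≠ 0 := by
    intro h
    have := congrArg im h
    simp at this
    rcases this with h | h <;> linarith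
  rw [e1, e2, log_ofReal_mul hR n1, log_ofReal_mul hR n2]
  ring

/-- Residue theorem for the strip `-1 ≤ Im v ≤ 0`, for functions with simple poles which are odd
under the reflection `v ↦ -i - v` exchanging the two edges of the strip. -/
theorem integral_eq_sum_residues_of_odd_reflection {F : ℂ → ℂ} {P : Finset ℂ} {r : ℂ → ℂ} {C X : ℝ}
    (hP : ∀ p ∈ P, -1 < p.im ∧ p.im < 0)
    (hd : ∀ v : ℂ, -1 ≤ v.im → v.im ≤ 0 → v ∉ P → DifferentiableAt ℂ F v)
    (hr : ∀ p ∈ P, Tendsto (fun v => (v - p) * F v) (𝓝[≠] p) (𝓝 (r p)))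
    (hsymm : ∀ v, F (-I - v) = -F v)
    (hint : Integrable (fun x : ℝ => F x))
    (hbound : ∀ v : ℂ, -1 ≤ v.im → v.im ≤ 0 → X ≤ |v.re| → ‖F v‖ ≤ C / |v.re|) :
    ∫ x : ℝ, F x = -(Real.pi * I) * ∑ p ∈ P, r p := by
  obtain ⟨G, hG, hGF⟩ := exists_differentiableAt_sub_principalParts
    (S := {v | -1 ≤ v.im ∧ v.im ≤ 0}) P r
    (fun p hp => by
      have ho : IsOpen {v : ℂ | -1 < v.im ∧ v.im < 0} :=
        (isOpen_lt continuous_const continuous_im).inter (isOpen_lt continuous_im continuous_const)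
      exact mem_of_superset (ho.mem_nhds (hP p hp)) fun v hv => ⟨hv.1.le, hv.2.le⟩)
    (fun v hv => hd v hv.1 hv.2) hr
  set M : ℝ := ∑ p ∈ P, ‖p‖ with hM
  have hpM : ∀ p ∈ P, ‖p‖ ≤ M := fun p hp =>
    Finset.single_le_sum (f := fun p : ℂ => ‖p‖) (fun _ _ => norm_nonneg _) hp
  have hPim : ∀ p ∈ P, ∀ x : ℝ, (x : ℂ) ≠ p := fun p hp x h => by
    have := (hP p hp).2
    rw [← h] at this
    simp at this
  have hxP : ∀ x : ℝ, (x : ℂ) ∉ P := fun x h => hPim _ h x rfl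
  have hxP' : ∀ x : ℝ, (x : ℂ) - I ∉ P := fun x h => by
    have := (hP _ h).1
    simp at this
  -- integrals over the horizontal edges
  have hcont1 : ∀ p ∈ P, Continuous fun x : ℝ => 1 / ((x : ℂ) + -p) := fun p hp =>
    continuous_const.div (by fun_prop) fun x h => hPim p hp x (by linear_combination h)
  have hcont2 : ∀ p ∈ P, Continuous fun x : ℝ => 1 / ((x : ℂ) + (I + p)) := fun p hp =>
    continuous_const.div (by fun_prop) fun x h => by
      have h1 := congrArg im h
      have h2 := (hP p hp).1
      simp at h1
      linarith
  have hFi : ∀ R : ℝ, IntervalIntegrable (fun x : ℝ => F x) volume (-R) R := fun R =>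
    hint.intervalIntegrable
  have htop : ∀ R : ℝ, ∫ x in (-R)..R, G x =
      (∫ x in (-R)..R, F x) - ∑ p ∈ P, r p * ∫ x in (-R)..R, 1 / ((x : ℂ) + -p) := by
    intro R
    have h1 : ∀ x : ℝ, G x = F x - ∑ p ∈ P, r p * (1 / ((x : ℂ) + -p)) := fun x => by
      rw [hGF _ (hxP x)]
      congr 1
      exact Finset.sum_congr rfl fun p _ => by rw [mul_one_div, sub_eq_add_neg]
    simp_rw [h1]
    rw [intervalIntegral.integral_sub (hFi R), intervalIntegral.integral_finsetSum]
    · simp_rw [intervalIntegral.integral_const_mul]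
    · exact fun p hp => ((hcont1 p hp).intervalIntegrable _ _).const_mul _
    · exact (continuous_finsetSum _ fun p hp =>
        continuous_const.mul (hcont1 p hp)).intervalIntegrable _ _
  have hbot : ∀ R : ℝ, ∫ x in (-R)..R, G (x - I) =
      -(∫ x in (-R)..R, F x) + ∑ p ∈ P, r p * ∫ x in (-R)..R, 1 / ((x : ℂ) + (I + p)) := by
    intro R
    -- After `x ↦ -x` the lower edge is the reflection of the upper one, so `F` contributes `-F x`,
    -- while each principal part again becomes `1/(x + c)` with `Im c > 0`.
    have h1 : ∀ x : ℝ, G ((-x : ℝ) - I) = -F x + ∑ p ∈ P, r p * (1 / ((x : ℂ) + (I + p))) := by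
      intro x
      have e : (((-x : ℝ) : ℂ) - I) = -I - x := by push_cast; ring
      rw [hGF _ (hxP' _), e, hsymm, sub_eq_add_neg, ← Finset.sum_neg_distrib]
      congr 1
      refine Finset.sum_congr rfl fun p _ => ?_
      rw [mul_one_div, show -I - (x : ℂ) - p = -(x + (I + p)) by ring, div_neg, neg_neg]
    have h2 := intervalIntegral.integral_comp_neg (a := -R) (b := R)
      (fun x : ℝ => G ((x : ℂ) - I))
    rw [neg_neg] at h2
    rw [← h2]
    simp_rw [h1]
    rw [intervalIntegral.integral_add (f := fun x : ℝ => -F x) (hFi R).neg, intervalIntegral.integral_finsetSum,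
      intervalIntegral.integral_neg]
    · simp_rw [intervalIntegral.integral_const_mul]
    · exact fun p hp => ((hcont2 p hp).intervalIntegrable _ _).const_mul _
    · exact (continuous_finsetSum _ fun p hp =>
        continuous_const.mul (hcont2 p hp)).intervalIntegrable _ _
  -- integrals over the vertical edges
  set b : ℝ → ℝ := fun R => C / R + ∑ p ∈ P, ‖r p‖ / (R - ‖p‖) with hb
  have hb0 : Tendsto b atTop (𝓝 0) := by
    have h1 : Tendsto (fun R : ℝ => C / R) atTop (𝓝 0) := tendsto_const_nhds.div_atTop tendsto_id
    have h2 : Tendsto (fun R : ℝ => ∑ p ∈ P, ‖r p‖ / (R - ‖p‖)) atTop (𝓝 (∑ p ∈ P, 0)) :=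
      tendsto_finsetSum _ fun p _ => tendsto_const_nhds.div_atTop
        (tendsto_atTop_add_const_right _ _ tendsto_id)
    simpa using h1.add h2
  have hvert : ∀ R : ℝ, X ≤ R → M < R → ∀ v : ℂ, -1 ≤ v.im → v.im ≤ 0 → |v.re| = R →
      ‖G v‖ ≤ b R := by
    intro R hX hMR v h1 h2 h3
    have hRv : R ≤ ‖v‖ := h3 ▸ abs_re_le_norm v
    have hvP : v ∉ P := fun h => by linarith [hpM v h]
    rw [hGF v hvP]
    refine (norm_sub_le _ _).trans (add_le_add ?_ ?_)
    · have := hbound v h1 h2 (by rw [h3]; exact hX)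
      rwa [h3] at this
    · refine (norm_sum_le _ _).trans (Finset.sum_le_sum fun p hp => ?_)
      rw [norm_div]
      have h4 : R - ‖p‖ ≤ ‖v - p‖ := by linarith [norm_sub_norm_le v p]
      have h5 : 0 < R - ‖p‖ := by linarith [hpM p hp]
      gcongr
  have hside : ∀ σ : ℝ → ℝ, (∀ R, 0 < R → |σ R| = R) →
      Tendsto (fun R : ℝ => ∫ y in (-1 : ℝ)..0, G (σ R + y * I)) atTop (𝓝 0) := by
    intro σ hσ
    refine squeeze_zero_norm' ?_ hb0
    filter_upwards [eventually_gt_atTop 0, eventually_ge_atTop X, eventually_gt_atTop M]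
      with R hR0 hRX hRM
    refine (intervalIntegral.norm_integral_le_of_norm_le_const (C := b R) fun y hy => ?_).trans
      (by simp)
    rw [uIoc_of_le (by norm_num)] at hy
    exact hvert R hRX hRM _ (by simpa using hy.1.le) (by simpa using hy.2) (by simpa using hσ R hR0)
  have hrect : ∀ R : ℝ, (∫ x in (-R)..R, G (x - I)) - (∫ x in (-R)..R, G x) +
      I * (∫ y in (-1 : ℝ)..0, G (R + y * I)) -
      I * (∫ y in (-1 : ℝ)..0, G ((-R : ℝ) + y * I)) = 0 := by
    intro R
    have := integral_boundary_rect_eq_zero_of_differentiableOn G ⟨-R, -1⟩ ⟨R, 0⟩ ?_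
    · simpa [sub_eq_add_neg] using this
    · intro v hv
      refine (hG v ?_).differentiableWithinAt
      have := hv.2
      simp only [mem_preimage] at this
      rw [uIcc_of_le (by norm_num)] at this
      exact ⟨this.1, this.2⟩
  have hFlim : Tendsto (fun R : ℝ => ∫ x in (-R)..R, F x) atTop (𝓝 (∫ x : ℝ, F x)) :=
    intervalIntegral_tendsto_integral hint tendsto_neg_atTop_atBot tendsto_id
  have hS1 : Tendsto (fun R : ℝ => ∑ p ∈ P, r p * ∫ x in (-R)..R, 1 / ((x : ℂ) + -p)) atTop
      (𝓝 (∑ p ∈ P, r p * (-(Real.pi * I)))) :=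
    tendsto_finsetSum _ fun p hp => (tendsto_integral_inv_add
      (by simpa using (hP p hp).2)).const_mul _
  have hS2 : Tendsto (fun R : ℝ => ∑ p ∈ P, r p * ∫ x in (-R)..R, 1 / ((x : ℂ) + (I + p))) atTop
      (𝓝 (∑ p ∈ P, r p * (-(Real.pi * I)))) :=
    tendsto_finsetSum _ fun p hp => (tendsto_integral_inv_add
      (by simpa using by linarith [(hP p hp).1])).const_mul _
  -- The principal parts are not absolutely integrable on `ℝ`, hence the symmetric limits. Each edge
  -- contributes `-πi` per pole, so the limit of the rectangle identity is twice the claim up to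
  -- sign.
  have hlim := (((hFlim.neg.add hS2).sub (hFlim.sub hS1)).add
    ((hside (fun R => R) fun R h => abs_of_pos h).const_mul I)).sub
    ((hside (fun R => -R) fun R h => by rw [abs_neg, abs_of_pos h]).const_mul I)
  have hzero := tendsto_nhds_unique (hlim.congr fun R => by
    rw [← htop, ← hbot]; exact hrect R) tendsto_const_nhds
  rw [← Finset.sum_mul] at hzero
  linear_combination (-1 / 2 : ℂ) * hzero

end ContourIntegration

/-! ### Lower bounds for `ζ`, and its trivial zeros -/

section ZetaBounds
open Complex Filter Topology

/-- `|Γ(x + iy)| / Γ(x)` is nondecreasing in `x > 0`. -/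
lemma norm_Gamma_div_le {x₀ x y : ℝ} (hx₀ : 0 < x₀) (hx : x₀ ≤ x) :
    ‖Gamma (x₀ + y * I)‖ * Real.Gamma x ≤ ‖Gamma (x + y * I)‖ * Real.Gamma x₀ := by
  have hseq : ∀ s : ℂ, Tendsto (fun n => ‖GammaSeq s n‖) atTop (𝓝 ‖Gamma s‖) := fun s =>
    (GammaSeq_tendsto_Gamma s).norm
  have hre : ∀ t : ℝ, 0 < t → ‖Gamma (t : ℂ)‖ = Real.Gamma t := fun t ht => by
    rw [Gamma_ofReal, norm_real, Real.norm_of_nonneg (Real.Gamma_pos_of_pos ht).le]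
  rw [← hre x (hx₀.trans_le hx), ← hre x₀ hx₀]
  refine le_of_tendsto_of_tendsto ((hseq _).mul (hseq _)) ((hseq _).mul (hseq _)) ?_
  filter_upwards [eventually_gt_atTop 0] with n hn
  have hpow : ∀ s : ℂ, ‖(n : ℂ) ^ s‖ = (n : ℝ) ^ s.re := fun s => by
    rw [← norm_natCast_cpow_of_pos hn]
  -- In Euler's limit formula the powers of `n` and the factorials cancel; what remains is that each
  -- ratio `|x + j + iy| / (x + j)` decreases in `x`.
  have hprod : (∏ j ∈ Finset.range (n + 1), ‖(x : ℂ) + y * I + j‖) *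
      (∏ j ∈ Finset.range (n + 1), ‖(x₀ : ℂ) + j‖) ≤
      (∏ j ∈ Finset.range (n + 1), ‖(x₀ : ℂ) + y * I + j‖) *
      (∏ j ∈ Finset.range (n + 1), ‖(x : ℂ) + j‖) := by
    rw [← Finset.prod_mul_distrib, ← Finset.prod_mul_distrib]
    refine Finset.prod_le_prod (fun _ _ => by positivity) fun j _ => ?_
    rw [← norm_mul, ← norm_mul]
    refine (sq_le_sq₀ (norm_nonneg _) (norm_nonneg _)).1 ?_
    rw [← normSq_eq_norm_sq, ← normSq_eq_norm_sq]
    have hj : (0 : ℝ) ≤ j := Nat.cast_nonneg j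
    simp only [map_mul, normSq_apply, add_re, add_im, mul_re, mul_im, ofReal_re, ofReal_im, I_re,
      I_im, natCast_re, natCast_im]
    ring_nf
    have h1 : (x₀ + j) ^ 2 ≤ (x + j) ^ 2 := by gcongr
    nlinarith [mul_le_mul_of_nonneg_left h1 (sq_nonneg y)]
  have hpos : ∀ t u : ℝ, 0 < t → 0 < ∏ j ∈ Finset.range (n + 1), ‖(t : ℂ) + u * I + j‖ := by
    intro t u ht
    refine Finset.prod_pos fun j _ => norm_pos_iff.2 fun h => ?_
    have h1 := congrArg re h
    simp at h1
    have hj : (0 : ℝ) ≤ j := Nat.cast_nonneg j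
    linarith
  have p1 := hpos x y (hx₀.trans_le hx)
  have p2 := hpos x₀ y hx₀
  have p3 : 0 < ∏ j ∈ Finset.range (n + 1), ‖(x : ℂ) + j‖ := by
    simpa using hpos x 0 (hx₀.trans_le hx)
  have p4 : 0 < ∏ j ∈ Finset.range (n + 1), ‖(x₀ : ℂ) + j‖ := by simpa using hpos x₀ 0 hx₀
  simp only [GammaSeq, norm_div, norm_mul, hpow, norm_prod, add_re, mul_re, ofReal_re, ofReal_im,
    I_re, I_im, mul_zero, zero_mul, sub_zero, add_zero]
  rw [div_mul_div_comm, div_mul_div_comm, div_le_div_iff₀ (by positivity) (by positivity)]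
  have hN : 0 ≤ (n : ℝ) ^ x * ‖((n.factorial : ℕ) : ℂ)‖ * ((n : ℝ) ^ x₀ * ‖((n.factorial : ℕ) : ℂ)‖) := by
    positivity
  have := mul_le_mul_of_nonneg_left hprod hN
  linarith

/-- On the line `Re = 1/2`, `1 - s` is the conjugate of `s`, so the reflection formula computes the
modulus exactly. -/
lemma norm_Gamma_half_add_mul_I_sq (y : ℝ) :
    ‖Gamma ((1 / 2 : ℝ) + y * I)‖ ^ 2 * Real.cosh (Real.pi * y) = Real.pi := by
  have h1 : Gamma ((1 / 2 : ℝ) + y * I) * Gamma (1 - ((1 / 2 : ℝ) + y * I)) =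
      Real.pi / cosh (Real.pi * y) := by
    rw [Gamma_mul_Gamma_one_sub]
    congr 1
    rw [show (Real.pi : ℂ) * ((1 / 2 : ℝ) + y * I) = (Real.pi * y : ℂ) * I + Real.pi / 2 by
      push_cast; ring, sin_add_pi_div_two, cos_mul_I]
  have h2 : Gamma (1 - ((1 / 2 : ℝ) + y * I)) =
      (starRingEnd ℂ) (Gamma ((1 / 2 : ℝ) + y * I)) := by
    rw [← Gamma_conj]
    congr 1
    apply Complex.ext <;> simp
    norm_num
  rw [h2, mul_conj, normSq_eq_norm_sq] at h1
  have hc : cosh (Real.pi * y : ℂ) ≠ 0 := by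
    rw [← ofReal_mul, ← ofReal_cosh]
    exact_mod_cast (Real.cosh_pos _).ne'
  rw [eq_div_iff hc, ← ofReal_mul, ← ofReal_cosh] at h1
  exact_mod_cast h1

/-- A lower bound for the Gamma function in a right half-plane. -/
lemma Gamma_mul_exp_le_norm_Gamma {x : ℝ} (y : ℝ) (hx : 1 / 2 ≤ x) :
    Real.Gamma x * Real.exp (-(Real.pi * |y| / 2)) ≤ ‖Gamma (x + y * I)‖ := by
  have h1 := norm_Gamma_div_le (y := y) (by norm_num : (0 : ℝ) < 1 / 2) hx
  have h2 := norm_Gamma_half_add_mul_I_sq y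
  set g := ‖Gamma ((1 / 2 : ℝ) + y * I)‖ with hg
  have h3 : Real.cosh (Real.pi * y) ≤ Real.exp (Real.pi * |y|) := by
    rw [← Real.cosh_abs, abs_mul, abs_of_pos Real.pi_pos, Real.cosh_eq]
    have : Real.exp (-(Real.pi * |y|)) ≤ Real.exp (Real.pi * |y|) :=
      Real.exp_le_exp.2 (by have := mul_nonneg Real.pi_pos.le (abs_nonneg y); linarith)
    linarith
  have h4 : Real.pi ≤ (g * Real.exp (Real.pi * |y| / 2)) ^ 2 := by
    rw [mul_pow, ← Real.exp_nat_mul, show ((2 : ℕ) : ℝ) * (Real.pi * |y| / 2) = Real.pi * |y| by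
      push_cast; ring]
    calc Real.pi = g ^ 2 * Real.cosh (Real.pi * y) := h2.symm
      _ ≤ _ := by gcongr
  have h5 : √Real.pi ≤ g * Real.exp (Real.pi * |y| / 2) :=
    Real.sqrt_le_iff.2 ⟨by positivity, h4⟩
  rw [Real.Gamma_one_half_eq] at h1
  have h6 : √Real.pi * (Real.Gamma x * Real.exp (-(Real.pi * |y| / 2))) ≤
      √Real.pi * ‖Gamma (x + y * I)‖ := by
    have hG : 0 ≤ Real.Gamma x := (Real.Gamma_pos_of_pos (by linarith)).le
    calc _ ≤ g * Real.exp (Real.pi * |y| / 2) *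
          (Real.Gamma x * Real.exp (-(Real.pi * |y| / 2))) := by gcongr
      _ = g * Real.Gamma x := by
        rw [Real.exp_neg]; field_simp
      _ ≤ _ := by linarith
  exact le_of_mul_le_mul_left h6 (Real.sqrt_pos.2 Real.pi_pos)

/-- A unit step multiplies the function by `x / 2π`, which exceeds `1` once `x ≥ 7 > 2π`. Its
minimum over the compact interval `[7, 8]` is thus a bound for all larger `x`. -/
lemma exists_pos_le_rpow_mul_Gamma :
    ∃ m : ℝ, 0 < m ∧ ∀ x : ℝ, 7 ≤ x → m ≤ (2 * Real.pi) ^ (-x) * Real.Gamma x := by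
  have hc : ContinuousOn (fun x : ℝ => (2 * Real.pi) ^ (-x) * Real.Gamma x) (Set.Icc 7 8) := by
    refine ContinuousOn.mul ?_ fun x hx => ?_
    · exact (continuous_const.rpow continuous_neg
        fun _ => Or.inl (by positivity)).continuousOn
    · refine (Real.differentiableAt_Gamma fun n h => ?_).continuousAt.continuousWithinAt
      have := hx.1
      have : (0 : ℝ) ≤ n := n.cast_nonneg
      linarith
  obtain ⟨x₀, hx₀, hmin⟩ := isCompact_Icc.exists_isMinOn
    (Set.nonempty_Icc.2 (by norm_num)) hc
  refine ⟨(2 * Real.pi) ^ (-x₀) * Real.Gamma x₀, mul_pos (Real.rpow_pos_of_pos (by positivity) _)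
    (Real.Gamma_pos_of_pos (by linarith [hx₀.1])), ?_⟩
  have hind : ∀ n : ℕ, ∀ x ∈ Set.Icc (7 : ℝ) 8,
      (2 * Real.pi) ^ (-x₀) * Real.Gamma x₀ ≤
        (2 * Real.pi) ^ (-(x + n)) * Real.Gamma (x + n) := by
    intro n x hx
    induction n with
    | zero => simpa using hmin hx
    | succ k ih =>
      refine ih.trans ?_
      have hk : (0 : ℝ) ≤ k := k.cast_nonneg
      have h7 := hx.1
      have hG : 0 < Real.Gamma (x + k) := Real.Gamma_pos_of_pos (by linarith)
      have hR : 0 < (2 * Real.pi) ^ (-(x + k)) := Real.rpow_pos_of_pos (by positivity) _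
      rw [Nat.cast_succ, ← add_assoc, Real.Gamma_add_one (by linarith : x + k ≠ 0),
        neg_add (x + k) 1, Real.rpow_add (by positivity), Real.rpow_neg_one]
      have : 1 ≤ (2 * Real.pi)⁻¹ * (x + k) := by
        rw [inv_mul_eq_div, le_div_iff₀ (by positivity)]
        linarith [Real.pi_lt_d2]
      nlinarith [mul_pos hR hG]
  intro x hx
  have hf := Nat.floor_le (by linarith : 0 ≤ x - 7)
  have hf' := Nat.lt_floor_add_one (x - 7)
  have := hind ⌊x - 7⌋₊ (x - ⌊x - 7⌋₊) ⟨by linarith, by linarith⟩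
  simpa using this

open scoped LSeries.notation ArithmeticFunction.Moebius in
/-- `1 / ζ` is bounded in the half-plane `2 ≤ Re z`. -/
lemma exists_pos_le_norm_riemannZeta :
    ∃ c : ℝ, 0 < c ∧ ∀ z : ℂ, 2 ≤ z.re → c ≤ ‖riemannZeta z‖ := by
  have hs2 : Summable fun n => ‖LSeries.term ↗ArithmeticFunction.moebius 2 n‖ :=
    (ArithmeticFunction.LSeriesSummable_moebius_iff.2 (by norm_num)).norm
  set B := ∑' n, ‖LSeries.term ↗ArithmeticFunction.moebius 2 n‖ with hB
  have hB0 : 0 ≤ B := tsum_nonneg fun _ => norm_nonneg _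
  refine ⟨(B + 1)⁻¹, by positivity, fun z hz => ?_⟩
  have hprod := LSeries_one_mul_Lseries_moebius (s := z) (by linarith)
  rw [LSeries_one_eq_riemannZeta (by linarith)] at hprod
  have hM : ‖LSeries ↗ArithmeticFunction.moebius z‖ ≤ B := by
    refine tsum_of_norm_bounded hs2.hasSum fun n => ?_
    exact LSeries.norm_term_le_of_re_le_re _ (by simpa using hz) n
  have h1 := congrArg norm hprod
  rw [norm_mul, norm_one] at h1
  have h2 : 1 ≤ ‖riemannZeta z‖ * (B + 1) := by
    rw [← h1]
    gcongr
    linarith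
  rw [inv_eq_one_div, div_le_iff₀ (by positivity)]
  exact h2

lemma exp_sub_exp_div_two_le_norm_cos (w : ℂ) :
    (Real.exp |w.im| - Real.exp (-|w.im|)) / 2 ≤ ‖cos w‖ := by
  have h1 : ‖exp (w * I)‖ = Real.exp (-w.im) := by rw [norm_exp]; simp
  have h2 : ‖exp (-w * I)‖ = Real.exp w.im := by rw [norm_exp]; simp
  rw [cos, norm_div, norm_ofNat]
  gcongr
  rcases abs_cases w.im with ⟨h, _⟩ | ⟨h, _⟩ <;> rw [h]
  · rw [← h1, ← h2, add_comm]
    have := norm_sub_norm_le (exp (-w * I)) (-exp (w * I))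
    rwa [norm_neg, sub_neg_eq_add] at this
  · rw [neg_neg, ← h1, ← h2]
    have := norm_sub_norm_le (exp (w * I)) (-exp (-w * I))
    rwa [norm_neg, sub_neg_eq_add] at this

/-- `1 / ζ` is bounded far to the left, away from the real axis. -/
lemma exists_pos_le_norm_riemannZeta_of_re_le :
    ∃ c : ℝ, 0 < c ∧ ∀ s : ℂ, s.re ≤ -6 → 1 ≤ |s.im| → c ≤ ‖riemannZeta s‖ := by
  obtain ⟨c, hc, hcz⟩ := exists_pos_le_norm_riemannZeta
  obtain ⟨m, hm, hmx⟩ := exists_pos_le_rpow_mul_Gamma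
  have he : 0 < 1 - Real.exp (-Real.pi) := by
    have : Real.exp (-Real.pi) < 1 := Real.exp_lt_one_iff.2 (by linarith [Real.pi_pos])
    linarith
  refine ⟨m * (1 - Real.exp (-Real.pi)) * c, by positivity, fun s hs hsi => ?_⟩
  obtain ⟨z, rfl⟩ : ∃ z, s = 1 - z := ⟨1 - s, by ring⟩
  have hz : 7 ≤ z.re := by simp at hs; linarith
  have hy : 1 ≤ |z.im| := by simpa using hsi
  rw [riemannZeta_one_sub (fun n h => ?_) (fun h => ?_)]
  · have h1 : ‖(2 * Real.pi : ℂ) ^ (-z)‖ = (2 * Real.pi) ^ (-z.re) := by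
      have := norm_cpow_eq_rpow_re_of_pos (x := 2 * Real.pi) (by positivity) (-z)
      simpa using this
    have h2 : Real.Gamma z.re * Real.exp (-(Real.pi * |z.im| / 2)) ≤ ‖Gamma z‖ := by
      have := Gamma_mul_exp_le_norm_Gamma z.im (by linarith : 1 / 2 ≤ z.re)
      rwa [re_add_im] at this
    have h3 := exp_sub_exp_div_two_le_norm_cos (Real.pi * z / 2)
    have him : |((Real.pi : ℂ) * z / 2).im| = Real.pi * |z.im| / 2 := by
      rw [show (Real.pi : ℂ) * z / 2 = ((Real.pi / 2 : ℝ) : ℂ) * z by push_cast; ring,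
        im_ofReal_mul, abs_mul, abs_of_pos (by positivity)]
      ring
    rw [him] at h3
    set u := Real.pi * |z.im| / 2 with hu
    -- The decay `exp(-π|y|/2)` of `Γ` matches the growth of the cosine in the functional equation;
    -- `|y| ≥ 1` keeps the cosine away from its zeros.
    have h4 : (1 - Real.exp (-Real.pi)) / 2 ≤ Real.exp (-u) * ‖cos (Real.pi * z / 2)‖ := by
      have h5 : Real.exp (-u) * ((Real.exp u - Real.exp (-u)) / 2) = (1 - Real.exp (-(2 * u))) / 2 := by
        rw [← mul_div_assoc, mul_sub, ← Real.exp_add, ← Real.exp_add]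
        simp
        ring_nf
      have h6 : Real.exp (-(2 * u)) ≤ Real.exp (-Real.pi) := by
        refine Real.exp_le_exp.2 ?_
        rw [hu]
        nlinarith [Real.pi_pos]
      calc _ ≤ Real.exp (-u) * ((Real.exp u - Real.exp (-u)) / 2) := by rw [h5]; linarith
        _ ≤ _ := by gcongr
    have hGp : 0 < Real.Gamma z.re := Real.Gamma_pos_of_pos (by linarith)
    simp only [norm_mul, h1, norm_ofNat]
    have hR : 0 < (2 * Real.pi) ^ (-z.re) := Real.rpow_pos_of_pos (by positivity) _
    calc m * (1 - Real.exp (-Real.pi)) * c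
        ≤ ((2 * Real.pi) ^ (-z.re) * Real.Gamma z.re) *
          (2 * (Real.exp (-u) * ‖cos (Real.pi * z / 2)‖)) * ‖riemannZeta z‖ := by
          gcongr
          · exact hmx _ hz
          · linarith
          · exact hcz z (by linarith)
      _ = 2 * (2 * Real.pi) ^ (-z.re) * (Real.Gamma z.re * Real.exp (-u)) *
          ‖cos (Real.pi * z / 2)‖ * ‖riemannZeta z‖ := by ring
      _ ≤ _ := by gcongr
  · have := congrArg im h
    simp at this
    simp [this] at hy
    linarith
  · simp [h] at hy
    linarith

/-- Zeros in the closed left half-plane are trivial. -/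
lemma re_pos_of_mem_nontrivialZetaZeros {τ : ℂ} (hτ : τ ∈ nontrivialZetaZeros) : 0 < τ.re := by
  by_contra! hre
  obtain ⟨h0, hnt⟩ := hτ
  obtain ⟨z, rfl⟩ : ∃ z, τ = 1 - z := ⟨1 - τ, by ring⟩
  have hz : 1 ≤ z.re := by simp at hre; linarith
  have hz1 : z ≠ 1 := by
    rintro rfl
    rw [sub_self, riemannZeta_zero] at h0
    norm_num at h0
  have hzn : ∀ n : ℕ, z ≠ -n := by
    rintro n rfl
    simp at hz
    have : (0 : ℝ) ≤ n := n.cast_nonneg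
    linarith
  rw [riemannZeta_one_sub hzn hz1] at h0
  -- For `Re z ≥ 1` the cosine is the only factor of the functional equation that can vanish.
  have hcos : cos (Real.pi * z / 2) = 0 := by
    have h1 := riemannZeta_ne_zero_of_one_le_re hz
    have h2 := Gamma_ne_zero hzn
    have h3 : (2 * Real.pi : ℂ) ^ (-z) ≠ 0 := by
      rw [Ne, cpow_eq_zero_iff]
      simp [Real.pi_ne_zero]
    simpa [h1, h2, h3] using h0
  obtain ⟨k, hk⟩ := cos_eq_zero_iff.1 hcos
  have hzk : z = 2 * k + 1 := by
    have : (Real.pi : ℂ) ≠ 0 := ofReal_ne_zero.2 Real.pi_ne_zero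
    field_simp at hk
    linear_combination hk
  have hk1 : 1 ≤ k := by
    have h1 : 0 ≤ k := by
      rw [hzk] at hz
      simp at hz
      exact hz
    rcases h1.eq_or_lt with rfl | h
    · exact absurd (by simpa using hzk) hz1
    · exact h
  refine hnt ⟨(k - 1).toNat, ?_⟩
  have : (((k - 1).toNat : ℕ) : ℂ) = (k : ℂ) - 1 := by
    have : (((k - 1).toNat : ℕ) : ℤ) = k - 1 := Int.toNat_of_nonneg (by linarith)
    exact_mod_cast congrArg (Int.cast : ℤ → ℂ) this
  rw [this, hzk]
  ring

/-- The trivial zeros are simple. -/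
lemma deriv_riemannZeta_neg_two_mul_ne_zero {n : ℕ} (hn : 1 ≤ n) :
    deriv riemannZeta (-2 * (n : ℂ)) ≠ 0 := by
  set z₀ : ℂ := 1 + 2 * n with hz₀
  have hre : z₀.re = 1 + 2 * n := by simp [hz₀]
  have hn' : (1 : ℝ) ≤ n := by exact_mod_cast hn
  have hopen : ∀ᶠ z in 𝓝 z₀, 1 < z.re :=
    (isOpen_lt continuous_const continuous_re).mem_nhds (by simp only [Set.mem_ofPred_eq]; linarith)
  -- Near `1 + 2n` the function `ζ(1 - z)` is a nonvanishing factor times a cosine with a simple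
  -- zero.
  have hfe : (fun z => riemannZeta (1 - z)) =ᶠ[𝓝 z₀] fun z =>
      (2 * (2 * Real.pi) ^ (-z) * Gamma z * riemannZeta z) * cos (Real.pi * z / 2) := by
    filter_upwards [hopen] with z hz
    rw [riemannZeta_one_sub]
    · ring
    · rintro m rfl
      simp at hz
      have : (0 : ℝ) ≤ m := m.cast_nonneg
      linarith
    · rintro rfl
      simp at hz
  have hne : ∀ m : ℕ, z₀ ≠ -m := fun m h => by
    rw [h] at hre
    simp at hre
    have : (0 : ℝ) ≤ m := m.cast_nonneg
    linarith
  have h2pi : (2 * Real.pi : ℂ) ≠ 0 := by simp [Real.pi_ne_zero]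
  have hA : DifferentiableAt ℂ
      (fun z : ℂ => 2 * (2 * Real.pi) ^ (-z) * Gamma z * riemannZeta z) z₀ := by
    refine DifferentiableAt.mul (DifferentiableAt.mul ?_ (differentiableAt_Gamma _ hne))
      (differentiableAt_riemannZeta fun h => ?_)
    · exact (DifferentiableAt.const_cpow differentiableAt_id.neg (Or.inl h2pi)).const_mul 2
    · rw [h] at hre
      simp at hre
      linarith
  have hcos : HasDerivAt (fun z : ℂ => cos (Real.pi * z / 2))
      (-sin (Real.pi * z₀ / 2) * (Real.pi / 2)) z₀ := by
    have : HasDerivAt (fun z : ℂ => Real.pi * z / 2) (Real.pi / 2) z₀ := by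
      simpa using ((hasDerivAt_id z₀).const_mul (Real.pi : ℂ)).div_const 2
    exact this.ccos
  have hc0 : cos (Real.pi * z₀ / 2) = 0 := by
    rw [cos_eq_zero_iff]
    exact ⟨n, by rw [hz₀]; push_cast; ring⟩
  have hs0 : sin (Real.pi * z₀ / 2) ≠ 0 := fun h => by
    have := sin_sq_add_cos_sq (Real.pi * z₀ / 2)
    rw [h, hc0] at this
    norm_num at this
  have h1 := (hA.hasDerivAt.mul hcos).congr_of_eventuallyEq hfe
  rw [hc0, mul_zero, zero_add] at h1
  have hval : (1 : ℂ) - z₀ = -2 * n := by rw [hz₀]; ring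
  have hζ : DifferentiableAt ℂ riemannZeta (1 - z₀) := by
    refine differentiableAt_riemannZeta fun h => ?_
    have := congrArg re h
    simp [hre] at this
    linarith
  have h2 := HasDerivAt.comp z₀ hζ.hasDerivAt ((hasDerivAt_id z₀).const_sub 1)
  have h3 := h2.unique h1
  rw [hval] at h3
  intro h
  rw [h, zero_mul] at h3
  have hA0 : 2 * (2 * Real.pi : ℂ) ^ (-z₀) * Gamma z₀ * riemannZeta z₀ ≠ 0 := by
    refine mul_ne_zero (mul_ne_zero (mul_ne_zero two_ne_zero ?_) (Gamma_ne_zero hne))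
      (riemannZeta_ne_zero_of_one_le_re (by linarith))
    rw [Ne, cpow_eq_zero_iff]
    simp [Real.pi_ne_zero]
  have hpi : (Real.pi / 2 : ℂ) ≠ 0 := by simp [Real.pi_ne_zero]
  exact mul_ne_zero hA0 (mul_ne_zero (neg_ne_zero.2 hs0) hpi) h3.symm

end ZetaBounds

/-! ### The quadratic map and the region bounded by the parabola -/

section ParabolaGeometry
open Complex Filter Topology

/-- The quadratic map whose restriction to the strip `-1 ≤ Im v ≤ 0` double covers the closed
region bounded by the parabola. -/
noncomputable def parabolaMap (a v : ℂ) : ℂ := 4 * a * v * (v + I)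

/-- Completing the square: the map is even about the centre `-i/2` of the strip. -/
lemma parabolaMap_eq (a u : ℂ) : parabolaMap a (-I / 2 + u) = a + 4 * a * u ^ 2 := by
  unfold parabolaMap
  linear_combination (-a) * I_sq

lemma parabolaMap_reflect (a v : ℂ) : parabolaMap a (-I - v) = parabolaMap a v := by
  unfold parabolaMap
  ring

lemma complex_sqrt_sq (z : ℂ) : Complex.sqrt z ^ 2 = z := by
  simp [Complex.sqrt]

/-- Half the difference of the two preimages of `τ` under `parabolaMap a`. -/
noncomputable def halfPreimageGap (a τ : ℂ) : ℂ := Complex.sqrt (-a * (a - τ)) / (2 * a)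

lemma four_mul_halfPreimageGap_sq {a : ℂ} (ha : a ≠ 0) (τ : ℂ) :
    4 * a * halfPreimageGap a τ ^ 2 = τ - a := by
  rw [halfPreimageGap, div_pow, complex_sqrt_sq]
  field_simp
  ring

lemma parabolaMap_eq_iff {a : ℂ} (ha : a ≠ 0) (τ v : ℂ) :
    parabolaMap a v = τ ↔ v = -I / 2 + halfPreimageGap a τ ∨ v = -I / 2 - halfPreimageGap a τ := by
  obtain ⟨w, rfl⟩ : ∃ w, v = -I / 2 + w := ⟨v + I / 2, by ring⟩
  have h := four_mul_halfPreimageGap_sq ha τ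
  rw [parabolaMap_eq, sub_eq_add_neg (-I / 2), add_right_inj, add_right_inj, ← sq_eq_sq_iff_eq_or_eq_neg]
  have h4 : 4 * a ≠ 0 := by simp [ha]
  constructor
  · intro h1
    exact mul_left_cancel₀ h4 (by linear_combination h1 - h)
  · intro h1
    rw [h1]
    linear_combination h

/-- Since `s(v) ā = 4|a|² v(v+i)`, multiplication by `ā` straightens the axis of the parabola. The
defect of its equation has the sign of `Im v (Im v + 1)`, so it separates the open strip, its edges
and its complement. -/
lemma im_sq_sub_re_parabolaMap (a v : ℂ) :
    (parabolaMap a v * (starRingEnd ℂ) a).im ^ 2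
      - 4 * normSq a * (parabolaMap a v * (starRingEnd ℂ) a).re =
      16 * normSq a ^ 2 * (4 * v.re ^ 2 + 1) * (v.im * (v.im + 1)) := by
  simp only [parabolaMap, mul_re, mul_im, add_re, add_im, I_re, I_im, conj_re, conj_im,
    re_ofNat, im_ofNat, normSq_apply]
  ring

lemma exists_parabolaMap_eq {a : ℂ} (ha : a ≠ 0) (z : ℂ) : ∃ v, z = parabolaMap a v :=
  ⟨_, ((parabolaMap_eq_iff ha z _).2 (Or.inl rfl)).symm⟩

lemma parabolaMap_mem_parabolaInterior_iff {a : ℂ} (v : ℂ) (ha : a ≠ 0) :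
    parabolaMap a v ∈ parabolaInterior a ↔ -1 < v.im ∧ v.im < 0 := by
  -- A point of the interior comes with some preimage in the strip, not necessarily `v`. The defect
  -- depends only on the image, so all preimages agree.
  have key : ∀ w : ℂ, (parabolaMap a w * (starRingEnd ℂ) a).im ^ 2
      - 4 * normSq a * (parabolaMap a w * (starRingEnd ℂ) a).re < 0 ↔ -1 < w.im ∧ w.im < 0 := by
    intro w
    have hA := normSq_pos.2 ha
    have hK : 0 < 16 * normSq a ^ 2 * (4 * w.re ^ 2 + 1) := by positivity
    rw [im_sq_sub_re_parabolaMap]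
    constructor
    · intro h
      have h1 : w.im * (w.im + 1) < 0 := by
        by_contra! h2
        linarith [mul_nonneg hK.le h2]
      constructor <;> nlinarith
    · rintro ⟨h1, h2⟩
      exact mul_neg_of_pos_of_neg hK (mul_neg_of_neg_of_pos h2 (by linarith))
  constructor
  · rintro ⟨w, h1, h2, hw⟩
    rw [← key, hw]
    exact (key w).2 ⟨h1, h2⟩
  · rintro ⟨h1, h2⟩
    exact ⟨v, h1, h2, rfl⟩

lemma mem_parabolaInterior_iff {a : ℂ} (ha : a ≠ 0) (z : ℂ) :
    z ∈ parabolaInterior a ↔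
      (z * (starRingEnd ℂ) a).im ^ 2 < 4 * normSq a * (z * (starRingEnd ℂ) a).re := by
  obtain ⟨v, rfl⟩ := exists_parabolaMap_eq ha z
  have hA := normSq_pos.2 ha
  have hK : 0 < 16 * normSq a ^ 2 * (4 * v.re ^ 2 + 1) := by positivity
  rw [parabolaMap_mem_parabolaInterior_iff v ha, ← sub_neg (a := (_ * _ : ℂ).im ^ 2), im_sq_sub_re_parabolaMap]
  constructor
  · rintro ⟨h1, h2⟩
    exact mul_neg_of_pos_of_neg hK (mul_neg_of_neg_of_pos h2 (by linarith))
  · intro h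
    have h1 : v.im * (v.im + 1) < 0 := by
      by_contra! h2
      linarith [mul_nonneg hK.le h2]
    constructor <;> nlinarith

lemma parabolaMap_mem_boundingParabola {a v : ℂ} (hv : v.im = 0 ∨ v.im = -1) :
    parabolaMap a v ∈ boundingParabola a := by
  rcases hv with hv | hv
  · refine ⟨v.re, ?_⟩
    have : (v.re : ℂ) = v := by apply Complex.ext <;> simp [hv]
    rw [this, parabolaMap]
  · refine ⟨(-I - v).re, ?_⟩
    have : ((-I - v).re : ℂ) = -I - v := by apply Complex.ext <;> simp [hv]
    rw [this, ← parabolaMap_reflect, parabolaMap]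

lemma mem_boundingParabola_iff {a : ℂ} (ha : a ≠ 0) (z : ℂ) :
    z ∈ boundingParabola a ↔
      (z * (starRingEnd ℂ) a).im ^ 2 = 4 * normSq a * (z * (starRingEnd ℂ) a).re := by
  constructor
  · rintro ⟨v, rfl⟩
    have := im_sq_sub_re_parabolaMap a v
    rw [ofReal_im, zero_mul, mul_zero, sub_eq_zero] at this
    exact this
  · obtain ⟨v, rfl⟩ := exists_parabolaMap_eq ha z
    intro h
    have h1 := im_sq_sub_re_parabolaMap a v
    rw [h, sub_self, eq_comm, mul_eq_zero] at h1
    have hA := normSq_pos.2 ha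
    have hK : 16 * normSq a ^ 2 * (4 * v.re ^ 2 + 1) ≠ 0 := by positivity
    rcases mul_eq_zero.1 (h1.resolve_left hK) with h2 | h2
    · exact parabolaMap_mem_boundingParabola (Or.inl h2)
    · exact parabolaMap_mem_boundingParabola (Or.inr (by linarith))

/-- Far out in the strip, the quadratic map takes values far to the left and away from the real
axis. -/
lemma exists_parabolaMap_re_le {a : ℂ} (hre : a.re < 0) (him : 0 < a.im) :
    ∃ X : ℝ, 1 ≤ X ∧ ∀ v : ℂ, -1 ≤ v.im → v.im ≤ 0 → X ≤ |v.re| →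
      (parabolaMap a v).re ≤ -6 ∧ 1 ≤ |(parabolaMap a v).im| := by
  -- With `x = |Re v|`, the second entry gives `αx² + βx ≤ -2x`, hence real part at most `-8`; the
  -- third gives `βx² + αx ≥ x`, hence imaginary part at least `4`.
  refine ⟨max 1 (max ((a.im + 2) / (-a.re)) ((-a.re + 1) / a.im)), le_max_left _ _, ?_⟩
  intro v h1 h2 hX
  have hx1 : 1 ≤ |v.re| := (le_max_left _ _).trans hX
  have hx2 := (le_max_left _ _).trans ((le_max_right _ _).trans hX)
  have hx3 := (le_max_right _ _).trans ((le_max_right _ _).trans hX)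
  rw [div_le_iff₀ (by linarith)] at hx2
  rw [div_le_iff₀ him] at hx3
  set x := |v.re| with hx
  have hxx : v.re ^ 2 = x ^ 2 := (sq_abs _).symm
  set p := v.re ^ 2 - v.im * (v.im + 1) with hp
  set q := v.re * (2 * v.im + 1) with hq
  have hpx : x ^ 2 ≤ p := by rw [hp, hxx]; nlinarith
  have hqx : |q| ≤ x := by
    rw [hq, abs_mul]
    have : |2 * v.im + 1| ≤ 1 := abs_le.2 ⟨by linarith, by linarith⟩
    calc _ ≤ x * 1 := by gcongr
      _ = x := mul_one x
  obtain ⟨hq1, hq2⟩ := abs_le.1 hqx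
  have hR : (parabolaMap a v).re = 4 * (a.re * p - a.im * q) := by
    simp only [parabolaMap, mul_re, mul_im, add_re, add_im, I_re, I_im, re_ofNat, im_ofNat, hp, hq]
    ring
  have hI : (parabolaMap a v).im = 4 * (a.re * q + a.im * p) := by
    simp only [parabolaMap, mul_re, mul_im, add_re, add_im, I_re, I_im, re_ofNat, im_ofNat, hp, hq]
    ring
  rw [hR, hI]
  constructor
  · have e1 : a.re * p ≤ a.re * x ^ 2 := mul_le_mul_of_nonpos_left hpx hre.le
    have e2 : -(a.im * q) ≤ a.im * x := by nlinarith
    nlinarith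
  · refine le_trans ?_ (le_abs_self _)
    have e1 : a.im * x ^ 2 ≤ a.im * p := mul_le_mul_of_nonneg_left hpx him.le
    have e2 : a.re * x ≤ a.re * q := mul_le_mul_of_nonpos_left hq2 hre.le
    nlinarith

/-- The lower bound for `|ζ|` far out confines the preimages of the zeros to a compact rectangle,
and zeros in a compact set are finite in number. -/
lemma finite_riemannZetaZeros_inter_parabolaInterior {a : ℂ} (hre : a.re < 0) (him : 0 < a.im) :
    (riemannZetaZeros ∩ parabolaInterior a).Finite := by
  obtain ⟨X, hX, hfar⟩ := exists_parabolaMap_re_le hre him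
  obtain ⟨c, hc, hζ⟩ := exists_pos_le_norm_riemannZeta_of_re_le
  have hK : IsCompact (parabolaMap a '' (Set.Icc (-X) X ×ℂ Set.Icc (-1 : ℝ) 0)) := by
    refine (isCompact_Icc.reProdIm isCompact_Icc).image ?_
    unfold parabolaMap
    fun_prop
  refine hK.inter_riemannZetaZeros_finite.subset ?_
  rintro z ⟨hz, v, h1, h2, rfl⟩
  refine ⟨⟨v, ⟨?_, h1.le, h2.le⟩, rfl⟩, hz⟩
  by_contra hv
  have hv' : X ≤ |v.re| := by
    by_contra! h
    exact hv ⟨(abs_lt.1 h).1.le, (abs_lt.1 h).2.le⟩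
  obtain ⟨h3, h4⟩ := hfar v h1.le h2.le hv'
  have h5 := hζ _ h3 h4
  rw [parabolaMap, mem_riemannZetaZeros.1 hz, norm_zero] at h5
  linarith

/-- At `z = -2n` both sides of the inequality for the interior carry a factor `4n`; dividing it out
leaves the threshold that defines `N`. -/
lemma neg_two_mul_mem_parabolaInterior_iff {a : ℂ} (him : 0 < a.im) {n : ℕ} (hn : 1 ≤ n) :
    (-2 * (n : ℂ)) ∈ parabolaInterior a ↔ (n : ℝ) * a.im ^ 2 < -2 * a.re * normSq a := by
  have ha : a ≠ 0 := fun h => by simp [h] at him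
  have hn' : (0 : ℝ) < n := by exact_mod_cast hn
  rw [mem_parabolaInterior_iff ha]
  simp only [mul_re, mul_im, neg_re, neg_im, re_ofNat, im_ofNat, natCast_re, natCast_im, conj_re,
    conj_im]
  ring_nf
  constructor <;> intro h
  · have : (n : ℝ) * (n * a.im ^ 2) < n * (-2 * a.re * normSq a) := by linarith
    have := lt_of_mul_lt_mul_left this hn'.le
    linarith
  · have : (n : ℝ) * (n * a.im ^ 2) < n * (-2 * a.re * normSq a) :=
      mul_lt_mul_of_pos_left (by linarith) hn'
    linarith

lemma neg_two_mul_mem_boundingParabola {a : ℂ} (him : 0 < a.im) {n : ℕ} (hn : 1 ≤ n)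
    (h : (-2 * (n : ℂ)) ∈ boundingParabola a) : (n : ℝ) * a.im ^ 2 = -2 * a.re * normSq a := by
  have ha : a ≠ 0 := fun h => by simp [h] at him
  have hn' : (0 : ℝ) < n := by exact_mod_cast hn
  rw [mem_boundingParabola_iff ha] at h
  simp only [mul_re, mul_im, neg_re, neg_im, re_ofNat, im_ofNat, natCast_re, natCast_im, conj_re,
    conj_im] at h
  exact mul_left_cancel₀ hn'.ne' (by linear_combination (1 / 4) * h)

/-- The points of the critical line inside the parabola or on it. -/
lemma im_sq_le_re_critical_line_iff {α β ρ : ℝ} (hα : α < 0) :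
    (ρ * α - β / 2) ^ 2 ≤ 4 * (α ^ 2 + β ^ 2) * (α / 2 + ρ * β) ↔
      0 ≤ 4 * β ^ 2 + 2 * α ∧ tauMinus α β ≤ ρ ∧ ρ ≤ tauPlus α β := by
  have hα0 : α ≠ 0 := hα.ne
  have hα2 : 0 < α ^ 2 := by positivity
  set A := α ^ 2 + β ^ 2 with hA
  have hA0 : 0 < A := by positivity
  set m := (1 / 2) * (β * (4 * A + α) / α ^ 2) with hm
  have hm' : 2 * α ^ 2 * m = β * (4 * A + α) := by rw [hm]; field_simp
  -- Completing the square in `ρ`; `m` is the midpoint of `τ_{M₋}` and `τ_{M₊}`.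
  have key : α ^ 2 * ((ρ * α - β / 2) ^ 2 - 4 * A * (α / 2 + ρ * β)) =
      (α ^ 2 * (ρ - m)) ^ 2 - A ^ 2 * (4 * β ^ 2 + 2 * α) := by
    have : α ^ 2 * (ρ - m) = α ^ 2 * ρ - β * (4 * A + α) / 2 := by linear_combination -hm' / 2
    rw [this, hA]
    ring
  have h1 : (ρ * α - β / 2) ^ 2 ≤ 4 * A * (α / 2 + ρ * β) ↔
      (α ^ 2 * (ρ - m)) ^ 2 ≤ A ^ 2 * (4 * β ^ 2 + 2 * α) := by
    constructor <;> intro h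
    · nlinarith
    · by_contra! h'
      nlinarith
  rw [h1]
  have h2 : tauMinus α β = m - A * √(4 * β ^ 2 + 2 * α) / α ^ 2 := rfl
  have h3 : tauPlus α β = m + A * √(4 * β ^ 2 + 2 * α) / α ^ 2 := rfl
  rw [h2, h3]
  constructor
  · intro h
    have hd : 0 ≤ 4 * β ^ 2 + 2 * α := by
      by_contra! h'
      have := mul_neg_of_pos_of_neg (by positivity : 0 < A ^ 2) h'
      linarith [sq_nonneg (α ^ 2 * (ρ - m))]
    refine ⟨hd, ?_⟩
    have h4 : (α ^ 2 * (ρ - m)) ^ 2 ≤ (A * √(4 * β ^ 2 + 2 * α)) ^ 2 := by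
      rwa [mul_pow A, Real.sq_sqrt hd]
    obtain ⟨h5, h6⟩ := abs_le_of_sq_le_sq' h4 (by positivity)
    rw [sub_le_iff_le_add, ← sub_le_iff_le_add', le_div_iff₀ hα2, ← sub_le_iff_le_add', le_div_iff₀ hα2]
    constructor <;> linarith
  · rintro ⟨hd, h5, h6⟩
    rw [sub_le_iff_le_add, ← sub_le_iff_le_add', le_div_iff₀ hα2] at h5
    rw [← sub_le_iff_le_add', le_div_iff₀ hα2] at h6
    have h4 : (α ^ 2 * (ρ - m)) ^ 2 ≤ (A * √(4 * β ^ 2 + 2 * α)) ^ 2 :=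
      sq_le_sq' (by linarith) (by linarith)
    rwa [mul_pow A, Real.sq_sqrt hd] at h4

end ParabolaGeometry

/-! ### Poles, residues and decay of the integrand -/

section StripIntegral
open Complex Filter Topology MeasureTheory

lemma riemannZeta₁_eq_zero_iff (s : ℂ) : riemannZeta₁ s = 0 ↔ riemannZeta s = 0 := by
  by_cases hs : s = 1
  · simp [hs, riemannZeta_one_ne_zero]
  · simp [riemannZeta_eq_inv_sub_mul hs, sub_ne_zero.2 hs]

/-- Away from `1`, `ζ₁(s) = (s - 1) ζ(s)`; at a zero only one term of the product rule survives. -/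
lemma hasDerivAt_riemannZeta₁ {s : ℂ} (hs : riemannZeta s = 0) :
    HasDerivAt riemannZeta₁ ((s - 1) * deriv riemannZeta s) s := by
  have h1 : s ≠ 1 := fun h => riemannZeta_one_ne_zero (h ▸ hs)
  have h2 := ((hasDerivAt_id s).sub_const 1).mul (differentiableAt_riemannZeta h1).hasDerivAt
  rw [hs, mul_zero, zero_add] at h2
  refine h2.congr_of_eventuallyEq ?_
  filter_upwards [isOpen_ne.mem_nhds h1] with z hz
  have hz' : z - 1 ≠ 0 := sub_ne_zero.2 hz
  simp only [Pi.mul_apply, id_eq]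
  rw [riemannZeta_eq_inv_sub_mul hz]
  field_simp

lemma riemannZeta_ne_zero_of_re_neg {a : ℂ} (hre : a.re < 0) (him : 0 < a.im) :
    riemannZeta a ≠ 0 := by
  intro h
  by_cases ht : ∃ n : ℕ, a = -2 * ((n : ℂ) + 1)
  · obtain ⟨n, rfl⟩ := ht
    simp at him
  · exact hre.not_gt (re_pos_of_mem_nontrivialZetaZeros ⟨h, ht⟩)

/-- The integrand `1 / (ζ(4av(v+i)) cosh(πv))` with its removable singularities at the preimages
of `1` removed. -/
noncomputable def stripIntegrand (a v : ℂ) : ℂ :=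
  (parabolaMap a v - 1) / (riemannZeta₁ (parabolaMap a v) * cosh (Real.pi * v))

lemma stripIntegrand_eq {a v : ℂ} (h : parabolaMap a v ≠ 1) :
    stripIntegrand a v = 1 / (riemannZeta (parabolaMap a v) * cosh (Real.pi * v)) := by
  have h' := sub_ne_zero.2 h
  rw [stripIntegrand, riemannZeta_eq_inv_sub_mul h, mul_assoc, ← div_div 1, one_div, inv_inv]

/-- A shift by `πi` reverses the sign of `cosh`. This oddness is what makes the two edges of the
strip contribute equally. -/
lemma stripIntegrand_reflect (a v : ℂ) : stripIntegrand a (-I - v) = -stripIntegrand a v := by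
  have : cosh (Real.pi * (-I - v)) = -cosh (Real.pi * v) := by
    rw [show (Real.pi : ℂ) * (-I - v) = -(Real.pi * v + Real.pi * I) by ring, cosh_neg, cosh_add,
      cosh_mul_I, sinh_mul_I]
    simp
  rw [stripIntegrand, stripIntegrand, parabolaMap_reflect, this, mul_neg, div_neg]

lemma hasDerivAt_parabolaMap (a u : ℂ) :
    HasDerivAt (parabolaMap a) (8 * a * u) (-I / 2 + u) := by
  have h1 := ((hasDerivAt_id (-I / 2 + u)).const_mul (4 * a)).mul
    ((hasDerivAt_id (-I / 2 + u)).add_const I)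
  refine h1.congr_deriv ?_
  simp only [id_eq]
  ring

lemma differentiable_parabolaMap (a : ℂ) : Differentiable ℂ (parabolaMap a) := by
  unfold parabolaMap
  fun_prop

lemma cosh_pi_mul_neg_I_div_two_add (u : ℂ) :
    cosh (Real.pi * (-I / 2 + u)) = -I * sinh (Real.pi * u) := by
  rw [show (Real.pi : ℂ) * (-I / 2 + u) = Real.pi * u - (Real.pi / 2) * I by ring, cosh_sub,
    cosh_mul_I, sinh_mul_I, cos_pi_div_two, sin_pi_div_two]
  ring

lemma sinh_pi_mul_neg_I_div_two_add (u : ℂ) :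
    sinh (Real.pi * (-I / 2 + u)) = -I * cosh (Real.pi * u) := by
  rw [show (Real.pi : ℂ) * (-I / 2 + u) = Real.pi * u - (Real.pi / 2) * I by ring, sinh_sub,
    cosh_mul_I, sinh_mul_I, cos_pi_div_two, sin_pi_div_two]
  ring

/-- The zeros of `sinh πu` are the integer multiples of `i`. With `u` measured from `-i/2`, this
keeps the poles coming from `ζ` apart from those of `1 / cosh`. -/
lemma sinh_pi_mul_ne_zero {u : ℂ} (hu : |u.im| < 1) (hu0 : u ≠ 0) : sinh (Real.pi * u) ≠ 0 := by
  intro h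
  have h1 : sin (Real.pi * u * I) = 0 := by rw [sin_mul_I, h, zero_mul]
  obtain ⟨k, hk⟩ := sin_eq_zero_iff.1 h1
  have hpi : (Real.pi : ℂ) ≠ 0 := ofReal_ne_zero.2 Real.pi_ne_zero
  have h2 : u * I = k := mul_left_cancel₀ hpi (by linear_combination hk)
  have h3 : u = -k * I := by linear_combination (-I) * h2 + u * I_sq
  have h4 : u.im = -k := by rw [h3]; simp
  rw [h4, abs_neg] at hu
  have : k = 0 := by
    have : |k| < 1 := by exact_mod_cast hu
    exact Int.abs_lt_one_iff.1 this
  exact hu0 (by rw [h3, this]; simp)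

lemma abs_re_le_norm_cosh_pi_mul (v : ℂ) : |v.re| ≤ ‖cosh (Real.pi * v)‖ := by
  have h := exp_sub_exp_div_two_le_norm_cos (Real.pi * v * I)
  rw [cos_mul_I, ← Real.sinh_eq] at h
  refine le_trans ?_ h
  have h1 : (Real.pi * v * I).im = Real.pi * v.re := by simp
  rw [h1, abs_mul, abs_of_pos Real.pi_pos]
  have h2 : 0 ≤ Real.pi * |v.re| := by positivity
  refine le_trans ?_ (Real.self_le_sinh_iff.2 h2)
  nlinarith [Real.pi_gt_three, abs_nonneg v.re]

lemma one_add_sq_le_cosh_pi_mul (x : ℝ) : 1 + x ^ 2 ≤ Real.cosh (Real.pi * x) := by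
  rw [← Real.cosh_abs, abs_mul, abs_of_pos Real.pi_pos]
  have h1 : Real.cosh (Real.pi * |x|) = 1 + 2 * Real.sinh (Real.pi * |x| / 2) ^ 2 := by
    have h2 := Real.cosh_two_mul (Real.pi * |x| / 2)
    rw [Real.cosh_sq, mul_div_cancel₀ _ (two_ne_zero)] at h2
    linarith
  have h3 : |x| ≤ Real.sinh (Real.pi * |x| / 2) := by
    have h2 : 0 ≤ Real.pi * |x| / 2 := by positivity
    refine le_trans ?_ (Real.self_le_sinh_iff.2 h2)
    nlinarith [Real.pi_gt_three, abs_nonneg x]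
  have h4 : x ^ 2 ≤ Real.sinh (Real.pi * |x| / 2) ^ 2 := by
    rw [← sq_abs x]
    gcongr
  rw [h1]
  nlinarith [sq_nonneg x]

/-- A simple pole of a quotient. -/
lemma tendsto_sub_mul_div_of_hasDerivAt {h D : ℂ → ℂ} {p d : ℂ} (hh : ContinuousAt h p)
    (hD : HasDerivAt D d p) (hp : D p = 0) (hd : d ≠ 0) :
    Tendsto (fun v => (v - p) * (h v / D v)) (𝓝[≠] p) (𝓝 (h p / d)) := by
  have h1 := hasDerivAt_iff_tendsto_slope.1 hD
  refine ((hh.tendsto.mono_left nhdsWithin_le_nhds).div h1 hd).congr fun v => ?_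
  rw [Pi.div_apply, slope_def_field, hp, sub_zero, div_div_eq_mul_div, mul_comm (h v), mul_div_assoc]

/-- The residue at the centre of the strip. -/
lemma tendsto_sub_mul_stripIntegrand_center {a : ℂ} (hre : a.re < 0) (him : 0 < a.im) :
    Tendsto (fun v => (v - (-I / 2)) * stripIntegrand a v) (𝓝[≠] (-I / 2))
      (𝓝 (I / (Real.pi * riemannZeta a))) := by
  have ha1 : a ≠ 1 := by rintro rfl; simp at him
  have hs : parabolaMap a (-I / 2) = a := by simpa using parabolaMap_eq a 0
  have hs' : HasDerivAt (parabolaMap a) 0 (-I / 2) := by simpa using hasDerivAt_parabolaMap a 0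
  have hc0 : cosh (Real.pi * (-I / 2)) = 0 := by simpa using cosh_pi_mul_neg_I_div_two_add 0
  have hs0 : sinh (Real.pi * (-I / 2)) = -I := by simpa using sinh_pi_mul_neg_I_div_two_add 0
  have hcd : HasDerivAt (fun v : ℂ => cosh (Real.pi * v)) (-I * Real.pi) (-I / 2) := by
    have := ((hasDerivAt_id (-I / 2)).const_mul (Real.pi : ℂ)).ccosh
    simpa [hs0] using this
  -- The centre is the critical point of the quadratic map, so only the derivative of `cosh` enters
  -- the residue.
  have hζ : HasDerivAt (fun v => riemannZeta₁ (parabolaMap a v))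
      (deriv riemannZeta₁ (parabolaMap a (-I / 2)) * 0) (-I / 2) :=
    (differentiable_riemannZeta₁ _).hasDerivAt.comp (-I / 2) hs'
  have hD := hζ.mul hcd
  simp only [hs, hc0, mul_zero, zero_add] at hD
  have hζa := riemannZeta_ne_zero_of_re_neg hre him
  have hζ1 : riemannZeta₁ a ≠ 0 := fun h => hζa ((riemannZeta₁_eq_zero_iff a).1 h)
  have hpi : (Real.pi : ℂ) ≠ 0 := ofReal_ne_zero.2 Real.pi_ne_zero
  have h := tendsto_sub_mul_div_of_hasDerivAt (h := fun v => parabolaMap a v - 1)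
    ((differentiable_parabolaMap a).continuous.sub continuous_const).continuousAt hD
    (by simp [hc0]) (mul_ne_zero hζ1 (mul_ne_zero (neg_ne_zero.2 I_ne_zero) hpi))
  have hval : (parabolaMap a (-I / 2) - 1) / (riemannZeta₁ a * (-I * Real.pi)) =
      I / (Real.pi * riemannZeta a) := by
    rw [hs, riemannZeta_eq_inv_sub_mul ha1]
    have := sub_ne_zero.2 ha1
    have := I_ne_zero
    field_simp
    rw [I_sq]
  rw [hval] at h
  exact h

/-- The residue at a preimage of a simple zero. -/
lemma tendsto_sub_mul_stripIntegrand {a u τ : ℂ} (ha : a ≠ 0) (hu : |u.im| < 1) (hu0 : u ≠ 0)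
    (hτ : parabolaMap a (-I / 2 + u) = τ) (hζ : riemannZeta τ = 0) (hd : deriv riemannZeta τ ≠ 0) :
    Tendsto (fun v => (v - (-I / 2 + u)) * stripIntegrand a v) (𝓝[≠] (-I / 2 + u))
      (𝓝 (I / (8 * a * (u * deriv riemannZeta τ * sinh (Real.pi * u))))) := by
  have hτ1 : τ - 1 ≠ 0 := sub_ne_zero.2 fun h => riemannZeta_one_ne_zero (h ▸ hζ)
  have hζ1 : riemannZeta₁ τ = 0 := (riemannZeta₁_eq_zero_iff τ).2 hζ
  have hcd : DifferentiableAt ℂ (fun v : ℂ => cosh (Real.pi * v)) (-I / 2 + u) := by fun_prop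
  have hz := hasDerivAt_riemannZeta₁ hζ
  rw [← hτ] at hz
  have hD := (hz.comp (-I / 2 + u) (hasDerivAt_parabolaMap a u)).mul hcd.hasDerivAt
  simp only [Function.comp_apply] at hD
  rw [hτ, hζ1, zero_mul, add_zero, cosh_pi_mul_neg_I_div_two_add] at hD
  have hsinh := sinh_pi_mul_ne_zero hu hu0
  have hI := I_ne_zero
  have h := tendsto_sub_mul_div_of_hasDerivAt (h := fun v => parabolaMap a v - 1)
    ((differentiable_parabolaMap a).continuous.sub continuous_const).continuousAt hD
    (by simp [hτ, hζ1]) (by simp [hτ1, hd, ha, hu0, hsinh])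
  rw [hτ] at h
  have hval : (τ - 1) / ((τ - 1) * deriv riemannZeta τ * (8 * a * u) * (-I * sinh (Real.pi * u))) =
      I / (8 * a * (u * deriv riemannZeta τ * sinh (Real.pi * u))) := by
    field_simp
    rw [I_sq, neg_div]
  rw [hval] at h
  exact h

/-- The factor `-πi` comes from the residue theorem and the factor `2` counts the two preimages of
`τ`. -/
lemma nontrivialZeroTerm_eq {a : ℂ} (ha : a ≠ 0) (τ : ℂ) :
    nontrivialZeroTerm a τ = -(Real.pi * I) * (2 * (I / (8 * a * (halfPreimageGap a τ *
      deriv riemannZeta τ * sinh (Real.pi * halfPreimageGap a τ))))) := by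
  have h1 : Complex.sqrt (-a * (a - τ)) = 2 * a * halfPreimageGap a τ := by
    rw [halfPreimageGap]
    field_simp
  have h2 : (Real.pi : ℂ) * Complex.sqrt (-a * (a - τ)) / (2 * a) = Real.pi * halfPreimageGap a τ := by
    rw [halfPreimageGap]
    ring
  rw [nontrivialZeroTerm, h2, h1]
  generalize halfPreimageGap a τ = u
  rw [show 2 * a * u * deriv riemannZeta τ * sinh (Real.pi * u) =
    2 * a * (u * deriv riemannZeta τ * sinh (Real.pi * u)) by ring]
  generalize u * deriv riemannZeta τ * sinh (Real.pi * u) = w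
  simp only [div_eq_mul_inv, mul_inv, one_mul]
  norm_num
  linear_combination (Real.pi * (a⁻¹ * w⁻¹) / 4 : ℂ) * I_sq

/-- The roots of `-a(a + 2n)` are `±i` times that of `a² + 2an`, which turns `sinh` into `sin` and
produces the minus sign. The summand is even in the root, so the branch is immaterial. -/
lemma nontrivialZeroTerm_neg_two_mul (a : ℂ) (n : ℕ) :
    nontrivialZeroTerm a (-2 * (n : ℂ)) = -trivialZeroTerm a n := by
  rw [nontrivialZeroTerm, trivialZeroTerm]
  set t := Complex.sqrt (a ^ 2 + 2 * a * n) with ht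
  set c := Complex.sqrt (-a * (a - -2 * (n : ℂ))) with hc
  have h : c ^ 2 = (t * I) ^ 2 := by
    rw [mul_pow, ht, hc, complex_sqrt_sq, complex_sqrt_sq, I_sq]
    ring
  have hsin : sinh (Real.pi * (t * I) / (2 * a)) = sin (Real.pi * t / (2 * a)) * I := by
    rw [← sinh_mul_I]
    congr 1
    ring
  have hcs : c * sinh (Real.pi * c / (2 * a)) = -(t * sin (Real.pi * t / (2 * a))) := by
    rcases sq_eq_sq_iff_eq_or_eq_neg.1 h with h | h
    · rw [h, hsin]
      linear_combination (t * sin (Real.pi * t / (2 * a))) * I_sq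
    · rw [h, mul_neg, neg_div, sinh_neg, hsin]
      linear_combination (t * sin (Real.pi * t / (2 * a))) * I_sq
  rw [show c * deriv riemannZeta (-2 * (n : ℂ)) * sinh (Real.pi * c / (2 * a)) =
      -(deriv riemannZeta (-2 * (n : ℂ)) * t * sin (Real.pi * t / (2 * a))) by
    linear_combination deriv riemannZeta (-2 * (n : ℂ)) * hcs, div_neg, mul_neg]

/-- The only pole of `1 / cosh (π v)` in the closed strip. -/
lemma eq_neg_I_div_two_of_cosh_eq_zero {v : ℂ} (h1 : -1 ≤ v.im) (h2 : v.im ≤ 0)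
    (h : cosh (Real.pi * v) = 0) : v = -I / 2 := by
  by_contra hne
  have hu0 : v + I / 2 ≠ 0 := fun h => hne (by linear_combination h)
  refine sinh_pi_mul_ne_zero (u := v + I / 2) ?_ hu0 ?_
  · have : (v + I / 2).im = v.im + 1 / 2 := by simp
    rw [this, abs_lt]
    constructor <;> linarith
  · have h3 := cosh_pi_mul_neg_I_div_two_add (v + I / 2)
    rw [show -I / 2 + (v + I / 2) = v by ring, h] at h3
    exact (mul_eq_zero.1 h3.symm).resolve_left (neg_ne_zero.2 I_ne_zero)

lemma differentiableAt_stripIntegrand {a v : ℂ} (h1 : riemannZeta (parabolaMap a v) ≠ 0)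
    (h2 : cosh (Real.pi * v) ≠ 0) : DifferentiableAt ℂ (stripIntegrand a) v := by
  have hs := (differentiable_parabolaMap a v)
  refine DifferentiableAt.div (hs.sub_const 1) ?_
    (mul_ne_zero (fun h => h1 ((riemannZeta₁_eq_zero_iff _).1 h)) h2)
  exact ((differentiable_riemannZeta₁ _).comp v hs).mul (by fun_prop)

lemma cosh_pi_mul_ofReal_ne_zero (x : ℝ) : cosh (Real.pi * (x : ℂ)) ≠ 0 := by
  rw [← ofReal_mul, ← ofReal_cosh]
  exact ofReal_ne_zero.2 (Real.cosh_pos _).ne'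

lemma exists_norm_stripIntegrand_le {a : ℂ} (hre : a.re < 0) (him : 0 < a.im) :
    ∃ X C : ℝ, 1 ≤ X ∧ 0 < C ∧ ∀ v : ℂ, -1 ≤ v.im → v.im ≤ 0 → X ≤ |v.re| →
      ‖stripIntegrand a v‖ ≤ C / ‖cosh (Real.pi * v)‖ := by
  obtain ⟨X, hX, hfar⟩ := exists_parabolaMap_re_le hre him
  obtain ⟨c, hc, hζ⟩ := exists_pos_le_norm_riemannZeta_of_re_le
  refine ⟨X, c⁻¹, hX, by positivity, fun v h1 h2 h3 => ?_⟩
  obtain ⟨h4, h5⟩ := hfar v h1 h2 h3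
  have hne : parabolaMap a v ≠ 1 := fun h => by
    rw [h] at h4
    norm_num at h4
  have h6 := hζ _ h4 h5
  have h7 : 0 < ‖cosh (Real.pi * v)‖ := by
    linarith [abs_re_le_norm_cosh_pi_mul v]
  rw [stripIntegrand_eq hne, norm_div, norm_mul, norm_one, inv_eq_one_div, div_div]
  gcongr

lemma integrable_stripIntegrand {a : ℂ} (hre : a.re < 0) (him : 0 < a.im)
    (hbd : ∀ z ∈ boundingParabola a, riemannZeta z ≠ 0) :
    Integrable fun x : ℝ => stripIntegrand a x := by
  obtain ⟨X, C, hX, hC, hle⟩ := exists_norm_stripIntegrand_le hre him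
  have hcont : Continuous fun x : ℝ => stripIntegrand a x := by
    refine continuous_iff_continuousAt.2 fun x => ?_
    have : DifferentiableAt ℂ (stripIntegrand a) x := differentiableAt_stripIntegrand
      (hbd _ (parabolaMap_mem_boundingParabola (Or.inl (ofReal_im x))))
      (cosh_pi_mul_ofReal_ne_zero x)
    exact this.continuousAt.comp continuous_ofReal.continuousAt
  have hO : ∀ x : ℝ, X ≤ |x| → ‖stripIntegrand a x‖ ≤ C * ‖(1 + x ^ 2)⁻¹‖ := by
    intro x hx
    refine (hle x (by simp) (by simp) (by simpa using hx)).trans ?_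
    have h1 : ‖cosh (Real.pi * (x : ℂ))‖ = Real.cosh (Real.pi * x) := by
      rw [← ofReal_mul, ← ofReal_cosh, norm_real, Real.norm_of_nonneg (Real.cosh_pos _).le]
    have h2 := one_add_sq_le_cosh_pi_mul x
    rw [h1, Real.norm_of_nonneg (by positivity), div_eq_mul_inv]
    gcongr
  refine hcont.locallyIntegrable.integrable_of_isBigO_atBot_atTop
    (g := fun x => (1 + x ^ 2)⁻¹) (g' := fun x => (1 + x ^ 2)⁻¹) ?_
    (integrable_inv_one_add_sq.integrableAtFilter _) ?_
    (integrable_inv_one_add_sq.integrableAtFilter _)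
  · refine Asymptotics.IsBigO.of_bound C ?_
    filter_upwards [eventually_le_atBot (-X)] with x hx
    exact hO x (by rw [abs_of_nonpos (by linarith)]; linarith)
  · refine Asymptotics.IsBigO.of_bound C ?_
    filter_upwards [eventually_ge_atTop X] with x hx
    exact hO x (hx.trans (le_abs_self x))

/-- Evaluation of the integral by residues. -/
theorem integral_stripIntegrand {a : ℂ} (hre : a.re < 0) (him : 0 < a.im)
    (hbd : ∀ z ∈ boundingParabola a, riemannZeta z ≠ 0) (Z : Finset ℂ)
    (hZ : ∀ τ, τ ∈ Z ↔ riemannZeta τ = 0 ∧ τ ∈ parabolaInterior a)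
    (hsimple : ∀ τ ∈ Z, deriv riemannZeta τ ≠ 0) :
    ∫ x : ℝ, stripIntegrand a x = 1 / riemannZeta a + ∑ τ ∈ Z, nontrivialZeroTerm a τ := by
  classical
  have ha : a ≠ 0 := fun h => by simp [h] at him
  obtain ⟨X, C, hX, hC, hle⟩ := exists_norm_stripIntegrand_le hre him
  set g := halfPreimageGap a with hg
  have hg0 : ∀ τ ∈ Z, g τ ≠ 0 := fun τ hτ h => by
    have h1 := four_mul_halfPreimageGap_sq ha τ
    rw [← hg, h] at h1
    have h2 : τ = a := by linear_combination -h1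
    exact riemannZeta_ne_zero_of_re_neg hre him (h2 ▸ ((hZ τ).1 hτ).1)
  have hmap1 : ∀ τ, parabolaMap a (-I / 2 + g τ) = τ := fun τ =>
    (parabolaMap_eq_iff ha τ _).2 (Or.inl rfl)
  have hmap2 : ∀ τ, parabolaMap a (-I / 2 + -g τ) = τ := fun τ =>
    (parabolaMap_eq_iff ha τ _).2 (Or.inr rfl)
  set Q : Finset ℂ := Z.biUnion fun τ => {-I / 2 + g τ, -I / 2 + -g τ} with hQ
  have hQmem : ∀ p, p ∈ Q ↔ parabolaMap a p ∈ Z := by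
    intro p
    simp only [hQ, Finset.mem_biUnion, Finset.mem_insert, Finset.mem_singleton]
    constructor
    · rintro ⟨τ, hτ, rfl | rfl⟩
      · rwa [hmap1]
      · rwa [hmap2]
    · exact fun h => ⟨_, h, (parabolaMap_eq_iff ha _ p).1 rfl⟩
  have hQstrip : ∀ p ∈ Q, -1 < p.im ∧ p.im < 0 := fun p hp =>
    (parabolaMap_mem_parabolaInterior_iff p ha).1 ((hZ _).1 ((hQmem p).1 hp)).2
  have hcen : parabolaMap a (-I / 2) = a := by simpa using parabolaMap_eq a 0
  have hcQ : -I / 2 ∉ Q := fun h => by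
    have := (hQmem _).1 h
    rw [hcen, hZ] at this
    exact riemannZeta_ne_zero_of_re_neg hre him this.1
  -- Residues at the centre and at a preimage of a zero; `p + i/2` is the displacement `u` from the
  -- centre.
  set r : ℂ → ℂ := fun p => if p = -I / 2 then I / (Real.pi * riemannZeta a) else
    I / (8 * a * ((p + I / 2) * deriv riemannZeta (parabolaMap a p) *
      sinh (Real.pi * (p + I / 2)))) with hr
  have hrQ : ∀ p ∈ Q, r p = I / (8 * a * ((p + I / 2) * deriv riemannZeta (parabolaMap a p) *
      sinh (Real.pi * (p + I / 2)))) := fun p hp =>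
    if_neg (show p ≠ -I / 2 from fun h => hcQ (h ▸ hp))
  have hmain := integral_eq_sum_residues_of_odd_reflection (F := stripIntegrand a)
    (P := insert (-I / 2) Q) (r := r) (C := C) (X := X) ?_ ?_ ?_ (stripIntegrand_reflect a)
    (integrable_stripIntegrand hre him hbd) ?_
  · rw [hmain, Finset.sum_insert hcQ, hQ, Finset.sum_biUnion, mul_add, Finset.mul_sum]
    · congr 1
      · have := riemannZeta_ne_zero_of_re_neg hre him
        have hpi : (Real.pi : ℂ) ≠ 0 := ofReal_ne_zero.2 Real.pi_ne_zero
        rw [hr]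
        simp only [if_true]
        field_simp
        rw [I_sq, neg_neg]
      · refine Finset.sum_congr rfl fun τ hτ => ?_
        have hne : -I / 2 + g τ ≠ -I / 2 + -g τ := fun h => hg0 τ hτ (by
          linear_combination (1 / 2 : ℂ) * h)
        rw [Finset.sum_pair hne, nontrivialZeroTerm_eq ha, hrQ _ ((hQmem _).2 (by rwa [hmap1])),
          hrQ _ ((hQmem _).2 (by rwa [hmap2])), hmap1, hmap2,
          show -I / 2 + g τ + I / 2 = g τ by ring, show -I / 2 + -g τ + I / 2 = -g τ by ring,
          mul_neg, sinh_neg]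
        ring
    · intro τ _ τ' _ hττ'
      rw [Function.onFun, Finset.disjoint_left]
      intro p hp hp'
      simp only [Finset.mem_insert, Finset.mem_singleton] at hp hp'
      exact hττ' (((parabolaMap_eq_iff ha τ p).2 hp).symm.trans ((parabolaMap_eq_iff ha τ' p).2 hp'))
  · intro p hp
    rcases Finset.mem_insert.1 hp with rfl | hp
    · simp
      norm_num
    · exact hQstrip p hp
  · intro v h1 h2 hv
    rw [Finset.mem_insert, not_or] at hv
    refine differentiableAt_stripIntegrand (fun h => ?_)
      fun h => hv.1 (eq_neg_I_div_two_of_cosh_eq_zero h1 h2 h)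
    rcases h2.eq_or_lt with h3 | h3
    · exact hbd _ (parabolaMap_mem_boundingParabola (Or.inl h3)) h
    rcases h1.eq_or_lt with h4 | h4
    · exact hbd _ (parabolaMap_mem_boundingParabola (Or.inr h4.symm)) h
    · exact hv.2 ((hQmem v).2 ((hZ _).2
        ⟨h, (parabolaMap_mem_parabolaInterior_iff v ha).2 ⟨h4, h3⟩⟩))
  · intro p hp
    rcases Finset.mem_insert.1 hp with rfl | hp
    · rw [hr]
      simp only [if_true]
      exact tendsto_sub_mul_stripIntegrand_center hre him
    · obtain ⟨h1, h2⟩ := hQstrip p hp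
      have hpZ := (hQmem p).1 hp
      have hp2 : -I / 2 + (p + I / 2) = p := by ring
      have := tendsto_sub_mul_stripIntegrand (u := p + I / 2) (τ := parabolaMap a p) ha ?_ ?_
        (by rw [hp2]) ((hZ _).1 hpZ).1 (hsimple _ hpZ)
      · rwa [hp2, ← hrQ p hp] at this
      · have : (p + I / 2).im = p.im + 1 / 2 := by simp
        rw [this, abs_lt]
        constructor <;> linarith
      · intro h
        exact hcQ ((by linear_combination -h : -I / 2 = p) ▸ hp)
  · intro v h1 h2 h3
    refine (hle v h1 h2 h3).trans ?_
    have := abs_re_le_norm_cosh_pi_mul v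
    have : 0 < |v.re| := by linarith
    gcongr

end StripIntegral

/-! ### Enclosed zeros, branches of the root, and the final identity -/

section Assembly
open Complex MeasureTheory

/-- The point `-2L` lies on the parabola only if `β²(2α + L) = -2α³`. The right side is positive,
which forces `2α + L > 0`, and solving for `β > 0` gives precisely the excluded value. -/
lemma riemannZeta_ne_zero_of_mem_boundingParabola {α β : ℝ} (hα : α < 0) (hβ : 0 < β) {a : ℂ}
    (ha : a = (α : ℂ) + (β : ℂ) * I)
    (hL : ∀ L : ℕ, 1 ≤ L → 0 < 2 * α + L →
      β ≠ -α * (√(-(4 * α + 2 * L) * α) / (2 * α + L)))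
    (hbd : ∀ τ ∈ nontrivialZetaZeros, τ ∉ boundingParabola a) :
    ∀ z ∈ boundingParabola a, riemannZeta z ≠ 0 := by
  intro z hz h0
  by_cases ht : ∃ n : ℕ, z = -2 * ((n : ℂ) + 1)
  · obtain ⟨n, rfl⟩ := ht
    have hre : a.re = α := by simp [ha]
    have him : a.im = β := by simp [ha]
    rw [← Nat.cast_succ] at hz
    have h1 := neg_two_mul_mem_boundingParabola (him ▸ hβ) (Nat.le_add_left 1 n) hz
    rw [normSq_apply, hre, him] at h1
    set x : ℝ := ((n + 1 : ℕ) : ℝ) with hx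
    have h2 : β ^ 2 * (2 * α + x) = -2 * α ^ 3 := by linear_combination h1
    have h3 : 0 < 2 * α + x := by
      have : 0 < -2 * α ^ 3 := by nlinarith [pow_pos (neg_pos.2 hα) 3]
      rw [← h2] at this
      exact pos_of_mul_pos_right this (sq_nonneg β)
    refine hL (n + 1) (Nat.le_add_left 1 n) h3 ?_
    have h4 : -(4 * α + 2 * x) * α = (β * (2 * α + x) / -α) ^ 2 := by
      have : α ≠ 0 := hα.ne
      field_simp
      linear_combination (-(2 * α + x)) * h2
    have h5 : 0 ≤ β * (2 * α + x) / -α := div_nonneg (by positivity) (by linarith)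
    rw [← hx, h4, Real.sqrt_sq h5]
    have : α ≠ 0 := hα.ne
    generalize 2 * α + x = y at h3
    field_simp
  · exact hbd z ⟨h0, ht⟩ hz

/-- The product of the principal roots of `a` and `τ - a` is the negative of the principal root of
their product when the arguments add up to more than `π`. -/
lemma sqrt_mul_sqrt_eq_neg {a τ : ℂ} (hre : a.re < 0) (him : 0 < a.im) (hτ : 0 < τ.re)
    (h : a.re * τ.im + (τ.re - 2 * a.re) * a.im < 0) :
    Complex.sqrt a * Complex.sqrt (-a + τ) = -Complex.sqrt (-a * (a - τ)) := by
  set w := -a + τ with hw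
  have hwre : 0 < w.re := by
    simp only [hw, add_re, neg_re]
    linarith
  have hprod : -a * (a - τ) = a * w := by rw [hw]; ring
  have him' : (a * w).im < 0 := by
    simp only [hw, mul_im, add_im, add_re, neg_re, neg_im]
    linarith
  have hA : 0 < (Complex.sqrt a).im := by
    rw [Complex.sqrt, cpow_inv_two_im_eq_sqrt him.le]
    refine Real.sqrt_pos.2 ?_
    have := norm_nonneg a
    linarith
  have hB : 0 < (Complex.sqrt w).re := by
    rw [Complex.sqrt, cpow_inv_two_re]
    refine Real.sqrt_pos.2 ?_
    have := norm_nonneg w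
    linarith
  have hC : 0 < (Complex.sqrt (a * w)).re ∧ (Complex.sqrt (a * w)).im < 0 := by
    have h1 : |(a * w).re| < ‖a * w‖ := abs_re_lt_norm.2 him'.ne
    rw [Complex.sqrt, cpow_inv_two_re, cpow_inv_two_im_eq_neg_sqrt him']
    refine ⟨Real.sqrt_pos.2 ?_, neg_lt_zero.2 (Real.sqrt_pos.2 ?_)⟩ <;>
      linarith [(abs_lt.1 h1).1, (abs_lt.1 h1).2]
  have hA' : |(Complex.sqrt a).re| < (Complex.sqrt a).im := by
    have h1 : ((Complex.sqrt a) ^ 2).re < 0 := by rwa [complex_sqrt_sq]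
    rw [sq, mul_re] at h1
    exact abs_lt_of_sq_lt_sq (by nlinarith) hA.le
  have hB' : |(Complex.sqrt w).im| < (Complex.sqrt w).re := by
    have h1 : 0 < ((Complex.sqrt w) ^ 2).re := by rwa [complex_sqrt_sq]
    rw [sq, mul_re] at h1
    exact abs_lt_of_sq_lt_sq (by nlinarith) hB.le
  have hsq : (Complex.sqrt a * Complex.sqrt w) ^ 2 = Complex.sqrt (a * w) ^ 2 := by
    rw [mul_pow, complex_sqrt_sq, complex_sqrt_sq, complex_sqrt_sq]
  rw [hprod]
  refine (sq_eq_sq_iff_eq_or_eq_neg.1 hsq).resolve_left fun heq => ?_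
  -- `√a` has argument in `(π/4, π/2)` and `√w` in `(-π/4, π/4)`, so the product lies in the upper
  -- half-plane, whereas `√(aw)` lies in the lower one.
  have h1 : 0 < (Complex.sqrt a * Complex.sqrt w).im := by
    rw [mul_im]
    obtain ⟨h2, h3⟩ := abs_lt.1 hA'
    obtain ⟨h4, h5⟩ := abs_lt.1 hB'
    have h6 : |(Complex.sqrt a).re * (Complex.sqrt w).im| <
        (Complex.sqrt a).im * (Complex.sqrt w).re := by
      rw [abs_mul]
      exact mul_lt_mul'' hA' hB' (abs_nonneg _) (abs_nonneg _)
    linarith [(abs_lt.1 h6).1]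
  rw [heq] at h1
  linarith [hC.2]

/-- No zero lies on the parabola itself, so the strict inequality for the interior may be replaced
by the closed range of ordinates. -/
lemma mem_enclosedZeros_iff_of_re_eq_half {α β : ℝ} (hα : α < 0) (hβ : 0 < β) {a : ℂ}
    (ha : a = (α : ℂ) + (β : ℂ) * I) {τ : ℂ} (hτ : τ ∈ nontrivialZetaZeros)
    (hbd : τ ∉ boundingParabola a) (hhalf : τ.re = 1 / 2) :
    τ ∈ enclosedZeros a ↔
      0 ≤ 4 * β ^ 2 + 2 * α ∧ tauMinus α β ≤ τ.im ∧ τ.im ≤ tauPlus α β := by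
  have hre : a.re = α := by simp [ha]
  have him : a.im = β := by simp [ha]
  have ha0 : a ≠ 0 := fun h => by
    rw [h, zero_im] at him
    exact hβ.ne him
  have hN : normSq a = α ^ 2 + β ^ 2 := by rw [normSq_apply, hre, him]; ring
  have h1 : (τ * (starRingEnd ℂ) a).im = τ.im * α - β / 2 := by
    simp only [mul_im, conj_re, conj_im, hre, him, hhalf]
    ring
  have h2 : (τ * (starRingEnd ℂ) a).re = α / 2 + τ.im * β := by
    simp only [mul_re, conj_re, conj_im, hre, him, hhalf]
    ring
  rw [mem_boundingParabola_iff ha0, h1, h2, hN] at hbd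
  rw [← im_sq_le_re_critical_line_iff hα, enclosedZeros, Set.mem_inter_iff,
    mem_parabolaInterior_iff ha0, h1, h2, hN]
  exact ⟨fun h => h.2.le, fun h => ⟨hτ, lt_of_le_of_ne h hbd⟩⟩

/-- The zeros of `ζ` inside the parabola are the enclosed nontrivial zeros and the first few trivial
zeros. -/
lemma mem_riemannZetaZeros_inter_parabolaInterior_iff {α β : ℝ} (hβ : 0 < β) {a : ℂ}
    (ha : a = (α : ℂ) + (β : ℂ) * I) (hbd : ∀ z ∈ boundingParabola a, riemannZeta z ≠ 0) (τ : ℂ) :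
    riemannZeta τ = 0 ∧ τ ∈ parabolaInterior a ↔ τ ∈ enclosedZeros a ∨
      ∃ n ∈ Finset.Icc 1 ⌊-2 * α * (α ^ 2 + β ^ 2) / β ^ 2⌋₊, -2 * (n : ℂ) = τ := by
  have hre : a.re = α := by simp [ha]
  have him : a.im = β := by simp [ha]
  have ha0 : a ≠ 0 := fun h => by
    rw [h, zero_im] at him
    exact hβ.ne him
  have hN : normSq a = α ^ 2 + β ^ 2 := by rw [normSq_apply, hre, him]; ring
  have key : ∀ n : ℕ, 1 ≤ n → ((-2 * (n : ℂ)) ∈ parabolaInterior a ↔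
      n ≤ ⌊-2 * α * (α ^ 2 + β ^ 2) / β ^ 2⌋₊) := by
    intro n hn
    rw [Nat.le_floor_iff' (by omega), le_div_iff₀ (by positivity),
      neg_two_mul_mem_parabolaInterior_iff (him ▸ hβ) hn, hre, him, hN]
    -- The floor allows equality; equality would put the trivial zero `-2n` on the parabola.
    refine ⟨le_of_lt, fun h => lt_of_le_of_ne h fun h' => ?_⟩
    obtain ⟨m, rfl⟩ : ∃ m, n = m + 1 := ⟨n - 1, by omega⟩
    refine hbd (-2 * ((m + 1 : ℕ) : ℂ)) ?_ ?_
    · have hn' : ((m + 1 : ℕ) : ℝ) ≠ 0 := by positivity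
      rw [mem_boundingParabola_iff ha0]
      simp only [mul_re, mul_im, neg_re, neg_im, re_ofNat, im_ofNat, natCast_re, natCast_im,
        conj_re, conj_im, hN, hre, him]
      linear_combination 4 * ((m + 1 : ℕ) : ℝ) * h'
    · rw [Nat.cast_succ]
      exact riemannZeta_neg_two_mul_nat_add_one m
  constructor
  · rintro ⟨h0, hin⟩
    by_cases ht : ∃ n : ℕ, τ = -2 * ((n : ℂ) + 1)
    · right
      obtain ⟨n, rfl⟩ := ht
      rw [← Nat.cast_succ] at hin
      exact ⟨n + 1, Finset.mem_Icc.2 ⟨by omega, (key _ (by omega)).1 hin⟩, by push_cast; ring⟩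
    · exact Or.inl ⟨⟨h0, ht⟩, hin⟩
  · rintro (⟨⟨h0, _⟩, hin⟩ | ⟨n, hn, rfl⟩)
    · exact ⟨h0, hin⟩
    · obtain ⟨h1, h2⟩ := Finset.mem_Icc.1 hn
      refine ⟨?_, (key n h1).2 h2⟩
      obtain ⟨m, rfl⟩ : ∃ m, n = m + 1 := ⟨n - 1, by omega⟩
      rw [Nat.cast_succ]
      exact riemannZeta_neg_two_mul_nat_add_one m

lemma finite_enclosedZeros {a : ℂ} (hre : a.re < 0) (him : 0 < a.im) : (enclosedZeros a).Finite :=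
  (finite_riemannZetaZeros_inter_parabolaInterior hre him).subset fun _ h => ⟨h.1.1, h.2⟩

/-- The two functions can differ only where `s(v) = 1`, since there `riemannZeta` takes a default
value. Comparing imaginary parts after multiplication by `ā` leaves at most one real `v`. -/
lemma integrand_ae_eq_stripIntegrand {a : ℂ} (him : 0 < a.im) :
    (fun v : ℝ => 1 / (riemannZeta (4 * a * v * (v + I)) * cosh (Real.pi * v))) =ᵐ[volume]
      fun v : ℝ => stripIntegrand a v := by
  have ha : a ≠ 0 := fun h => by simp [h] at him
  have hA := normSq_pos.2 ha
  filter_upwards [Measure.ae_ne volume (-a.im / (4 * normSq a))] with x hx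
  refine (stripIntegrand_eq fun h => hx ?_).symm
  have h1 := congrArg im (congrArg (· * (starRingEnd ℂ) a) h)
  simp only [parabolaMap, mul_re, mul_im, add_re, add_im, I_re, I_im, re_ofNat, im_ofNat, ofReal_re,
    ofReal_im, conj_re, conj_im, one_re, one_im] at h1
  rw [eq_div_iff (by positivity), normSq_apply]
  linear_combination h1

/-- The main identity, with the residues written with consistent square roots. -/
lemma integral_eq_trivial_add_nontrivial {α β : ℝ} (hα : α < 0) (hβ : 0 < β) {a : ℂ}
    (ha : a = (α : ℂ) + (β : ℂ) * I)
    (hbd : ∀ z ∈ boundingParabola a, riemannZeta z ≠ 0)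
    (hsimple : ∀ τ ∈ enclosedZeros a, deriv riemannZeta τ ≠ 0) :
    ∫ v : ℝ, stripIntegrand a v = 1 / riemannZeta a
        - ∑ n ∈ Finset.Icc 1 ⌊-2 * α * (α ^ 2 + β ^ 2) / β ^ 2⌋₊, trivialZeroTerm a n
        + ∑ᶠ τ ∈ enclosedZeros a, nontrivialZeroTerm a τ := by
  classical
  have hre : a.re < 0 := by simpa [ha] using hα
  have him : 0 < a.im := by simpa [ha] using hβ
  have hfin := finite_enclosedZeros hre him
  set N := ⌊-2 * α * (α ^ 2 + β ^ 2) / β ^ 2⌋₊ with hN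
  set T : Finset ℂ := (Finset.Icc 1 N).image fun n : ℕ => -2 * (n : ℂ) with hT
  have hinj : Function.Injective fun n : ℕ => -2 * (n : ℂ) := fun m n h => by
    have : (m : ℂ) = n := by linear_combination (-1 / 2 : ℂ) * h
    exact_mod_cast this
  have hdisj : Disjoint hfin.toFinset T := by
    rw [Finset.disjoint_left]
    intro τ hτ hτ'
    obtain ⟨n, hn, rfl⟩ := Finset.mem_image.1 hτ'
    obtain ⟨h1, -⟩ := Finset.mem_Icc.1 hn
    refine ((hfin.mem_toFinset).1 hτ).1.2 ⟨n - 1, ?_⟩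
    rw [Nat.cast_sub h1]
    ring
  rw [integral_stripIntegrand hre him hbd (hfin.toFinset ∪ T)]
  · rw [Finset.sum_union hdisj, finsum_mem_eq_finite_toFinset_sum _ hfin, hT,
      Finset.sum_image hinj.injOn]
    simp only [nontrivialZeroTerm_neg_two_mul, Finset.sum_neg_distrib]
    ring
  · intro τ
    rw [Finset.mem_union, hfin.mem_toFinset, Finset.mem_image,
      mem_riemannZetaZeros_inter_parabolaInterior_iff hβ ha hbd]
  · intro τ hτ
    rcases Finset.mem_union.1 hτ with h | h
    · exact hsimple τ (hfin.mem_toFinset.1 h)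
    · obtain ⟨n, hn, rfl⟩ := Finset.mem_image.1 h
      exact deriv_riemannZeta_neg_two_mul_ne_zero (Finset.mem_Icc.1 hn).1

end Assembly

theorem mainTheorem11 (α β : ℝ) (hα : α < 0) (hβ : 0 < β) (a : ℂ)
    (ha : a = (α : ℂ) + (β : ℂ) * Complex.I)
    -- no trivial zero lies on the bounding parabola
    (hL : ∀ L : ℕ, 1 ≤ L → 0 < 2 * α + L →
      β ≠ -α * (√(-(4 * α + 2 * L) * α) / (2 * α + L)))
    -- no nontrivial zero lies on the bounding parabola
    (hbd : ∀ τ ∈ nontrivialZetaZeros, τ ∉ boundingParabola a)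
    -- the enclosed nontrivial zeros are simple
    (hsimple : ∀ τ ∈ enclosedZeros a, deriv riemannZeta τ ≠ 0) :
    MeasureTheory.Integrable (fun v : ℝ =>
      1 / (riemannZeta (4 * a * v * (v + Complex.I)) * Complex.cosh (Real.pi * v))) ∧
    (enclosedZeros a).Finite ∧
    -- the identity, with the square roots in the residues taken consistently
    (∫ v : ℝ, 1 / (riemannZeta (4 * a * v * (v + Complex.I)) * Complex.cosh (Real.pi * v))
      = 1 / riemannZeta a
        - ∑ n ∈ Finset.Icc 1 ⌊-2 * α * (α ^ 2 + β ^ 2) / β ^ 2⌋₊, trivialZeroTerm a n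
        + ∑ᶠ τ ∈ enclosedZeros a, nontrivialZeroTerm a τ) ∧
    -- the form with `√a √(τ - a)`, principal roots throughout
    ((∀ τ ∈ enclosedZeros a, α * τ.im + (τ.re - 2 * α) * β < 0) →
      ∫ v : ℝ, 1 / (riemannZeta (4 * a * v * (v + Complex.I)) * Complex.cosh (Real.pi * v))
        = 1 / riemannZeta a
          - ∑ n ∈ Finset.Icc 1 ⌊-2 * α * (α ^ 2 + β ^ 2) / β ^ 2⌋₊, trivialZeroTerm a n
          - (Real.pi : ℂ) / (2 * Complex.sqrt a) *
            ∑ᶠ τ ∈ enclosedZeros a,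
              1 / (Complex.sqrt (-a + τ) * deriv riemannZeta τ *
                Complex.sinh (Real.pi * Complex.sqrt (-a * (a - τ)) / (2 * a)))) ∧
    -- which zeros on the critical line are enclosed
    (∀ τ ∈ nontrivialZetaZeros, τ.re = 1 / 2 →
      (τ ∈ enclosedZeros a ↔
        0 ≤ 4 * β ^ 2 + 2 * α ∧ tauMinus α β ≤ τ.im ∧ τ.im ≤ tauPlus α β)) ∧
    -- the range of summation if all nontrivial zeros lie on the critical line
    (RiemannHypothesis →
      enclosedZeros a = {τ ∈ nontrivialZetaZeros |
        0 ≤ 4 * β ^ 2 + 2 * α ∧ tauMinus α β ≤ τ.im ∧ τ.im ≤ tauPlus α β}) := by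
  have hre : a.re < 0 := by simpa [ha] using hα
  have him : 0 < a.im := by simpa [ha] using hβ
  have hζ := riemannZeta_ne_zero_of_mem_boundingParabola hα hβ ha hL hbd
  have hae := integrand_ae_eq_stripIntegrand him
  have hmain := (MeasureTheory.integral_congr_ae hae).trans
    (integral_eq_trivial_add_nontrivial hα hβ ha hζ hsimple)
  have hline : ∀ τ ∈ nontrivialZetaZeros, τ.re = 1 / 2 →
      (τ ∈ enclosedZeros a ↔
        0 ≤ 4 * β ^ 2 + 2 * α ∧ tauMinus α β ≤ τ.im ∧ τ.im ≤ tauPlus α β) := fun τ hτ hhalf =>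
    mem_enclosedZeros_iff_of_re_eq_half hα hβ ha hτ (hbd τ hτ) hhalf
  refine ⟨(integrable_stripIntegrand hre him hζ).congr hae.symm, finite_enclosedZeros hre him,
    hmain, fun hcond => ?_, hline, fun hRH => ?_⟩
  · rw [hmain, sub_eq_add_neg _ ((Real.pi : ℂ) / _ * _)]
    congr 1
    have ha0 : Complex.sqrt a ≠ 0 := fun h => by
      have := complex_sqrt_sq a
      rw [h] at this
      simp [← this] at him
    rw [← smul_eq_mul, ← neg_smul, smul_finsum_mem (finite_enclosedZeros hre him)]
    refine finsum_mem_congr rfl fun τ hτ => ?_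
    have h1 := sqrt_mul_sqrt_eq_neg hre him (re_pos_of_mem_nontrivialZetaZeros hτ.1)
      (by simpa [ha] using hcond τ hτ)
    rw [nontrivialZeroTerm, smul_eq_mul]
    generalize Complex.sinh _ = S
    rw [← neg_eq_iff_eq_neg.2 h1]
    simp only [div_eq_mul_inv, mul_inv, one_mul, neg_mul, inv_neg, mul_neg]
    ring
  · ext τ
    refine ⟨fun h => ⟨h.1, (hline τ h.1 ?_).1 h⟩, fun h => (hline τ h.1 ?_).2 h.2⟩
    -- `RiemannHypothesis` also asks for `τ ≠ 1`; this holds because the default value of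
    -- `riemannZeta` at `1` is nonzero.
    · exact hRH τ h.1.1 h.1.2 fun h' => riemannZeta_one_ne_zero (h' ▸ h.1.1)
    · exact hRH τ h.1.1 h.1.2 fun h' => riemannZeta_one_ne_zero (h' ▸ h.1.1)
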